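/- **Setting.** Let $f:\mathbb R^d\to\mathbb R$ be a quadratic function with constant symmetric Hessian $H$, and let $f$ be $L$-smooth, i.e. $\|\nabla f(x)-\nabla f(y)\|\le L\|x-y\|$ for all $x,y$. Let $\alpha>0$ and $0<\tau\le\zeta$, and assume $\tau\le L$. Put $$\mathcal S=\{\Sigma:\ \zeta^{-1}I\preceq\Sigma\preceq\tau^{-1}I\},\qquad \mathcal S'=\{\Sigma^{-1}:\Sigma\in\mathcal S\},$$ and let $\Pi_{\mathcal S'}$ be the nearest-point projection onto $\mathcal S'$ in the Frobenius norm $\|\cdot\|$. The algorithm MiNES with batch size one starts from some $\mu_1\in\mathbb R^d$ and $\Sigma_1\in\mathcal S$. For $k=1,2,\dots$ it draws independent $u_k\sim N(0,I_d)$ and sets $$\mu_{k+1}=\mu_k-\eta_1^{(k)}\,\frac{f(\mu_k+\alpha\Sigma_k^{1/2}u_k)-f(\mu_k-\alpha\Sigma_k^{1/2}u_k)}{2\alpha}\,\Sigma_k^{1/2}u_k,\qquad \Sigma_{k+1}^{-1}=\Pi_{\mathcal S'}\!\left(\Sigma_k^{-1}+\eta_2^{(k)}\tilde G_k\right),$$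 $$\tilde G_k=\frac{f(\mu_k-\alpha\Sigma_k^{1/2}u_k)+f(\mu_k+\alpha\Sigma_k^{1/2}u_k)-2f(\mu_k)}{2\alpha^2}\left(\Sigma_k^{-1/2}u_ku_k^\top\Sigma_k^{-1/2}-\Sigma_k^{-1}\right)-\Sigma_k^{-1},$$ where the step sizes $\eta_1^{(k)}\in\mathbb R$ are arbitrary and $\eta_2^{(k)}=1/k$. **Theorem.** Let $\delta\in(0,1/2)$ and let $T\ge4$ be an integer. Then, with probability at least $1-2\delta$, $$\left\|\Sigma_k^{-1}-\Pi_{\mathcal S'}(H)\right\|^2\le\frac{R'}{k}\qquad\text{simultaneously for all } 1\le k\le T,$$ where $$\begin{aligned}R'={}&16\left(\frac{16d^2\zeta^2L}{\tau}+\frac{2d^3L(\zeta^2-\tau^2)}{\tau}+dL\zeta+dL^2\right)\log^{5/4}\!\left(\frac{12+2592\,T}{\delta}\right)\\&+\frac{L^2\zeta^2}{\tau^2}\left(\left(2d+3\log\tfrac T\delta\right)^4+\left(2d+3\log\tfrac T\delta\right)^2\right)+2L^2.\end{aligned}$$ -/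

import Mathlib

open MeasureTheory ProbabilityTheory
open scoped MatrixOrder Matrix.Norms.Frobenius

namespace MiNES

/-- The space `ℝᵈ` with its Euclidean norm. -/
abbrev Vec (d : ℕ) : Type := EuclideanSpace ℝ (Fin d)

/-- Real `d × d` matrices. -/
abbrev Mat (d : ℕ) : Type := Matrix (Fin d) (Fin d) ℝ

noncomputable section

/-- The product of a matrix and a vector of `ℝᵈ`. -/
def app {d : ℕ} (A : Mat d) (v : Vec d) : Vec d := WithLp.toLp 2 (A.mulVec v.ofLp)

/-- The rank one matrix `u uᵀ`. -/
def outer {d : ℕ} (u : Vec d) : Mat d := Matrix.vecMulVec u.ofLp u.ofLp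

/-- The positive semidefinite square root `A^{1/2}` (used for positive definite `A`). -/
def matSqrt {d : ℕ} (A : Mat d) : Mat d := CFC.sqrt A

/-- `f` is quadratic with (symmetric, constant) Hessian matrix `H`:
`f(z) = f(μ) + ⟨∇f(μ), z - μ⟩ + (z - μ)ᵀ H (z - μ) / 2` for all `μ` and `z`. -/
def IsQuadratic {d : ℕ} (f : Vec d → ℝ) (H : Mat d) : Prop :=
  H.IsSymm ∧ ∀ μ z : Vec d,
    f z = f μ + inner ℝ (gradient f μ) (z - μ) + 1 / 2 * inner ℝ (z - μ) (app H (z - μ))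

/-- `f` is `L`-smooth: it is differentiable and its gradient is `L`-Lipschitz. -/
def IsSmooth {d : ℕ} (f : Vec d → ℝ) (L : ℝ) : Prop :=
  Differentiable ℝ f ∧ ∀ x y : Vec d, ‖gradient f x - gradient f y‖ ≤ L * ‖x - y‖

/-- The constraint set `𝒮 = {Σ | ζ⁻¹ I ≼ Σ ≼ τ⁻¹ I}` (Loewner order, so `Σ` is symmetric). -/
def covSet (d : ℕ) (τ ζ : ℝ) : Set (Mat d) :=
  {S | ζ⁻¹ • (1 : Mat d) ≤ S ∧ S ≤ τ⁻¹ • (1 : Mat d)}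

/-- The set `𝒮' = {Σ⁻¹ | Σ ∈ 𝒮}`. -/
def precSet (d : ℕ) (τ ζ : ℝ) : Set (Mat d) := {P | ∃ S ∈ covSet d τ ζ, P = S⁻¹}

open Classical in
/-- The projection of `A` onto `𝒮'`: the point of `𝒮'` nearest to `A` in Frobenius norm. -/
def proj {d : ℕ} (τ ζ : ℝ) (A : Mat d) : Mat d :=
  if h : ∃ P ∈ precSet d τ ζ, ∀ X ∈ precSet d τ ζ, ‖A - P‖ ≤ ‖A - X‖ then h.choose else 0

/-- `𝒮'` is the set of symmetric matrices `P` with `τ I ≼ P ≼ ζ I`. -/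
theorem mem_precSet_iff {d : ℕ} {τ ζ : ℝ} (hτ : 0 < τ) (hτζ : τ ≤ ζ) (P : Mat d) :
    P ∈ precSet d τ ζ ↔ τ • (1 : Mat d) ≤ P ∧ P ≤ ζ • (1 : Mat d) := by
  have hζ : 0 < ζ := hτ.trans_le hτζ
  have key : ∀ (a b : ℝ), 0 < a → 0 < b → ∀ S : Mat d, a • (1 : Mat d) ≤ S → S ≤ b • (1 : Mat d) →
      IsUnit S.det ∧ b⁻¹ • (1 : Mat d) ≤ S⁻¹ ∧ S⁻¹ ≤ a⁻¹ • (1 : Mat d) := by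
    intro a b ha hb S h1 h2
    have hS : S.PosDef := by
      have h := (Matrix.PosDef.one (n := Fin d) (R := ℝ)).smul ha
      have := h.add_posSemidef (Matrix.le_iff.1 h1)
      simpa using this
    have hR0 : (CFC.sqrt S⁻¹).IsHermitian := (Matrix.nonneg_iff_posSemidef.1 (CFC.sqrt_nonneg S⁻¹)).1
    have hRR : CFC.sqrt S⁻¹ * CFC.sqrt S⁻¹ = S⁻¹ :=
      CFC.sqrt_mul_sqrt_self _ hS.inv.posSemidef.nonneg
    have hdet : IsUnit S.det := (Matrix.isUnit_iff_isUnit_det S).1 hS.isUnit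
    have hRSR : CFC.sqrt S⁻¹ * S * CFC.sqrt S⁻¹ = 1 := by
      have h : CFC.sqrt S⁻¹ * (CFC.sqrt S⁻¹ * S) = 1 := by
        rw [← mul_assoc, hRR, Matrix.nonsing_inv_mul _ hdet]
      exact mul_eq_one_comm.1 h
    have conj : ∀ M : Mat d, M.PosSemidef → (CFC.sqrt S⁻¹ * M * CFC.sqrt S⁻¹).PosSemidef := by
      intro M hM
      have := hM.mul_mul_conjTranspose_same (CFC.sqrt S⁻¹)
      rwa [hR0.eq] at this
    refine ⟨hdet, ?_, ?_⟩
    · have h := (conj _ (Matrix.le_iff.1 h2)).smul (inv_nonneg.2 hb.le)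
      rw [mul_sub, sub_mul, hRSR, Matrix.mul_smul, Matrix.smul_mul, mul_one, hRR, smul_sub,
        smul_smul, inv_mul_cancel₀ hb.ne', one_smul] at h
      exact Matrix.le_iff.2 h
    · have h := (conj _ (Matrix.le_iff.1 h1)).smul (inv_nonneg.2 ha.le)
      rw [mul_sub, sub_mul, hRSR, Matrix.mul_smul, Matrix.smul_mul, mul_one, hRR, smul_sub,
        smul_smul, inv_mul_cancel₀ ha.ne', one_smul] at h
      exact Matrix.le_iff.2 h
  constructor
  · rintro ⟨S, ⟨h1, h2⟩, rfl⟩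
    have h := key _ _ (inv_pos.2 hζ) (inv_pos.2 hτ) S h1 h2
    simpa using h.2
  · rintro ⟨h1, h2⟩
    have h := key _ _ hτ hζ P h1 h2
    exact ⟨P⁻¹, h.2, (Matrix.nonsing_inv_nonsing_inv P h.1).symm⟩

/-- A nearest point of `𝒮'` exists, so that `proj` is a nearest point. -/
theorem proj_spec {d : ℕ} {τ ζ : ℝ} (hτ : 0 < τ) (hτζ : τ ≤ ζ) (A : Mat d) :
    proj τ ζ A ∈ precSet d τ ζ ∧
      ∀ X ∈ precSet d τ ζ, ‖A - proj τ ζ A‖ ≤ ‖A - X‖ := by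
  have hset : precSet d τ ζ = Set.Icc (τ • (1 : Mat d)) (ζ • (1 : Mat d)) := by
    ext P; exact mem_precSet_iff hτ hτζ P
  have hpsd : IsClosed {M : Mat d | M.PosSemidef} := by
    have : {M : Mat d | M.PosSemidef} = {M : Mat d | M.conjTranspose = M} ∩
        ⋂ x : Fin d → ℝ, {M : Mat d | 0 ≤ x ⬝ᵥ M.mulVec x} := by
      ext M
      simp only [Set.mem_inter_iff, Set.mem_iInter, Set.mem_ofPred_eq]
      rw [Matrix.posSemidef_iff_dotProduct_mulVec]
      simp [Matrix.IsHermitian]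
    rw [this]
    refine (isClosed_eq (by fun_prop) continuous_id).inter (isClosed_iInter fun x => ?_)
    exact isClosed_le continuous_const (by fun_prop)
  have hclosed : IsClosed (precSet d τ ζ) := by
    rw [hset]
    exact (hpsd.preimage (by fun_prop : Continuous fun P : Mat d => P - τ • (1 : Mat d))).inter
      (hpsd.preimage (by fun_prop : Continuous fun P : Mat d => ζ • (1 : Mat d) - P))
  have hne : (precSet d τ ζ).Nonempty := by
    refine ⟨τ • 1, (mem_precSet_iff hτ hτζ _).2 ⟨le_rfl, Matrix.le_iff.2 ?_⟩⟩
    rw [← sub_smul]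
    exact Matrix.PosSemidef.one.smul (sub_nonneg.2 hτζ)
  have hproper : ProperSpace (Mat d) := FiniteDimensional.proper ℝ (Mat d)
  obtain ⟨P, hP, hPd⟩ := hclosed.exists_infDist_eq_dist hne A
  have h : ∃ P ∈ precSet d τ ζ, ∀ X ∈ precSet d τ ζ, ‖A - P‖ ≤ ‖A - X‖ := by
    refine ⟨P, hP, fun X hX => ?_⟩
    rw [← dist_eq_norm, ← dist_eq_norm, ← hPd]
    exact Metric.infDist_le_dist_of_mem hX
  rw [proj, dif_pos h]
  exact h.choose_spec

/-- The nearest point of `𝒮'` is unique. -/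
theorem eq_proj {d : ℕ} {τ ζ : ℝ} (hτ : 0 < τ) (hτζ : τ ≤ ζ) (A P : Mat d)
    (hP : P ∈ precSet d τ ζ) (hmin : ∀ X ∈ precSet d τ ζ, ‖A - P‖ ≤ ‖A - X‖) :
    P = proj τ ζ A := by
  obtain ⟨hQ, hQmin⟩ := proj_spec hτ hτζ A
  set Q := proj τ ζ A
  have hsq : ∀ M : Mat d, ‖M‖ ^ 2 = ∑ i, ∑ j, M i j ^ 2 := by
    intro M
    have h0 : 0 ≤ ∑ i, ∑ j, M i j ^ 2 :=
      Finset.sum_nonneg fun i _ => Finset.sum_nonneg fun j _ => sq_nonneg _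
    rw [Matrix.frobenius_norm_def, ← Real.sqrt_eq_rpow]
    simp only [Real.norm_eq_abs, Real.rpow_two, sq_abs]
    exact Real.sq_sqrt h0
  have hmid : (1 / 2 : ℝ) • (P + Q) ∈ precSet d τ ζ := by
    rw [mem_precSet_iff hτ hτζ] at hP hQ ⊢
    have h1 := ((Matrix.le_iff.1 hP.1).add (Matrix.le_iff.1 hQ.1)).smul
      (by norm_num : (0 : ℝ) ≤ 1 / 2)
    have h2 := ((Matrix.le_iff.1 hP.2).add (Matrix.le_iff.1 hQ.2)).smul
      (by norm_num : (0 : ℝ) ≤ 1 / 2)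
    constructor
    · refine Matrix.le_iff.2 ?_
      convert h1 using 1
      module
    · refine Matrix.le_iff.2 ?_
      convert h2 using 1
      module
  have hPQ : ‖A - P‖ = ‖A - Q‖ := le_antisymm (hmin Q hQ) (hQmin P hP)
  have h4 : ‖P - Q‖ ^ 2 + 4 * ‖A - (1 / 2 : ℝ) • (P + Q)‖ ^ 2
      = 2 * ‖A - P‖ ^ 2 + 2 * ‖A - Q‖ ^ 2 := by
    simp only [hsq, Finset.mul_sum, ← Finset.sum_add_distrib]
    refine Finset.sum_congr rfl fun i _ => Finset.sum_congr rfl fun j _ => ?_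
    simp only [Matrix.sub_apply, Matrix.smul_apply, Matrix.add_apply, smul_eq_mul]
    ring
  have h5 := hmin _ hmid
  have h6 : ‖P - Q‖ ^ 2 ≤ 0 := by
    have := pow_le_pow_left₀ (norm_nonneg _) h5 2
    rw [← hPQ] at h4
    linarith
  have h7 : ‖P - Q‖ = 0 := by
    have := sq_nonneg ‖P - Q‖
    exact pow_eq_zero_iff (two_ne_zero) |>.1 (le_antisymm h6 this)
  exact sub_eq_zero.1 (norm_eq_zero.1 h7)

/-- The gradient estimate
`g̃ = (1/b) ∑ᵢ (f(μ + α Σ^{1/2} uᵢ) - f(μ - α Σ^{1/2} uᵢ)) / (2α) • Σ^{1/2} uᵢ`. -/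
def gEst {d b : ℕ} (f : Vec d → ℝ) (α : ℝ) (μ : Vec d) (S : Mat d) (u : Fin b → Vec d) : Vec d :=
  (1 / (b : ℝ)) • ∑ i, ((f (μ + α • app (matSqrt S) (u i)) - f (μ - α • app (matSqrt S) (u i)))
    / (2 * α)) • app (matSqrt S) (u i)

/-- The estimate
`G̃ = 1/(2bα²) ∑ᵢ (f(μ - α Σ^{1/2} uᵢ) + f(μ + α Σ^{1/2} uᵢ) - 2 f(μ))
  • (Σ^{-1/2} uᵢ uᵢᵀ Σ^{-1/2} - Σ⁻¹) - Σ⁻¹`. -/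
def GEst {d b : ℕ} (f : Vec d → ℝ) (α : ℝ) (μ : Vec d) (S : Mat d) (u : Fin b → Vec d) : Mat d :=
  (1 / (2 * (b : ℝ) * α ^ 2)) • ∑ i,
    (f (μ - α • app (matSqrt S) (u i)) + f (μ + α • app (matSqrt S) (u i)) - 2 * f μ) •
      ((matSqrt S)⁻¹ * outer (u i) * (matSqrt S)⁻¹ - S⁻¹) - S⁻¹

/-- One iteration `(μ, Σ) ↦ (μ⁺, Σ⁺)` with samples `u` and step sizes `η₁, η₂`:
`μ⁺ = μ - η₁ g̃` and `(Σ⁺)⁻¹ = Π_{𝒮'}(Σ⁻¹ + η₂ G̃)`. -/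
def step {d b : ℕ} (f : Vec d → ℝ) (α τ ζ η₁ η₂ : ℝ) (u : Fin b → Vec d)
    (θ : Vec d × Mat d) : Vec d × Mat d :=
  (θ.1 - η₁ • gEst f α θ.1 θ.2 u, (proj τ ζ (θ.2⁻¹ + η₂ • GEst f α θ.1 θ.2 u))⁻¹)

/-- The iterates `θ_k = (μ_k, Σ_k)`, `k ≥ 1`, started from `θ_1 = (μ₁, Σ₁)`; iteration `k` uses
the step sizes `η₁ k`, `η₂ k` and the samples `u k`. (The index `0` is not used: `θ_0 = θ_1`.) -/
def iter {d b : ℕ} (f : Vec d → ℝ) (α τ ζ : ℝ) (η₁ η₂ : ℕ → ℝ) (θ₁ : Vec d × Mat d)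
    (u : ℕ → Fin b → Vec d) : ℕ → Vec d × Mat d
  | 0 => θ₁
  | 1 => θ₁
  | k + 2 => step f α τ ζ (η₁ (k + 1)) (η₂ (k + 1)) (u (k + 1)) (iter f α τ ζ η₁ η₂ θ₁ u (k + 1))

/-- The constant `R'` of the high probability bound. -/
def rateConst (d : ℕ) (L ζ τ δ : ℝ) (T : ℕ) : ℝ :=
  16 * (16 * (d : ℝ) ^ 2 * ζ ^ 2 * L / τ + 2 * (d : ℝ) ^ 3 * L * (ζ ^ 2 - τ ^ 2) / τ
      + d * L * ζ + d * L ^ 2) * Real.log ((12 + 2592 * (T : ℝ)) / δ) ^ ((5 : ℝ) / 4)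
    + (L ^ 2 * ζ ^ 2 / τ ^ 2 * ((2 * (d : ℝ) + 3 * Real.log (T / δ)) ^ 4
        + (2 * (d : ℝ) + 3 * Real.log (T / δ)) ^ 2) + 2 * L ^ 2)

end

end MiNES

/-! For quadratic `f` the second difference in `G̃` equals `α² uᵀ Σ^{1/2} H Σ^{1/2} u` exactly, so
`μ` and `α` drop out and the precision matrices follow a recursion of their own. By a Gaussian
fourth moment identity the conditional mean of `G̃` is `H - Σ⁻¹`.

Write `X_n = Σ_{n+1}⁻¹`, `Y = Π(H)`, `a_n = ‖X_n - Y‖²`, and let `Z_n` be the noise of `G̃` paired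
with `X_n - Y`. The projection brings points no farther from `Y`, and its variational inequality
gives `⟨H - X, X - Y⟩ ≤ -‖X - Y‖²`. With step `1/(n+1)` and weight `n(n+1)` the errors telescope
(`sq_error_recursion`): `(n+1) n a_{n+1} ≤ 2 ∑_{i ≤ n} i Z_i + n B`, where `B` bounds `‖G̃‖²`.

The noise is a quartic polynomial in a Gaussian vector and in general has no exponential moments.
Truncating from above repairs this: `exp (min z 1) ≤ 1 + z + z²` needs only mean zero and a second
moment, here at most `(d² + 30d)(Lζ/τ)² a_n`. This yields an exponential supermartingale
(`lintegral_exp_expProcess_le`), and Markov with a union bound controls the truncated sums for all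
`n < T` up to probability `δ`. A chi-square tail bounds every `‖u_k‖²` by `M = 2d + 3 log(T/δ)` up
to another `δ`; there the truncation is inactive.

The resulting bound contains the `a_i` themselves, and strong induction closes it
(`rate_of_recursion`): with `R` the target constant, inserting `(i+1) a_i ≤ R` costs only `R/4`, the
logarithmic term `4R/15`, and `B` at most `9R/25`. All this holds with `(Lζ/τ)² M⁴` below `R`, and
that quantity is a single summand of `R'`. -/

namespace MiNES

/-! ### One-dimensional Gaussian moments. -/

section GaussianMoments

lemma integrable_pow_mul_exp_neg_sq (n : ℕ) :
    Integrable fun x : ℝ => x ^ n * Real.exp (-(1 / 2) * x ^ 2) := by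
  have h := integrable_rpow_mul_exp_neg_mul_sq (b := 1 / 2) (by norm_num) (s := n)
    (by have : (0 : ℝ) ≤ n := n.cast_nonneg
        linarith)
  simpa only [Real.rpow_natCast] using h

lemma integral_gaussianReal_eq (g : ℝ → ℝ) :
    ∫ x, g x ∂(gaussianReal 0 1)
      = (√(2 * Real.pi))⁻¹ * ∫ x, g x * Real.exp (-(1 / 2) * x ^ 2) := by
  rw [integral_gaussianReal_eq_integral_smul one_ne_zero, ← integral_const_mul]
  refine integral_congr_ae (ae_of_all _ fun x => ?_)
  simp only [gaussianPDFReal, NNReal.coe_one, mul_one, sub_zero, smul_eq_mul]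
  rw [show -x ^ 2 / 2 = -(1 / 2) * x ^ 2 by ring]
  ring

/-- Integration by parts: the derivative of `x^(n+1) e^{-x²/2}` has integral zero. -/
lemma integral_pow_gaussianReal_step (n : ℕ) :
    ∫ x, x ^ (n + 2) ∂(gaussianReal 0 1) = (n + 1) * ∫ x, x ^ n ∂(gaussianReal 0 1) := by
  have hd : ∀ x : ℝ, HasDerivAt (fun x : ℝ => x ^ (n + 1) * Real.exp (-(1 / 2) * x ^ 2))
      ((n + 1) * (x ^ n * Real.exp (-(1 / 2) * x ^ 2))
        - x ^ (n + 2) * Real.exp (-(1 / 2) * x ^ 2)) x := by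
    intro x
    have h1 := hasDerivAt_pow (n + 1) x
    have h2 := ((hasDerivAt_pow 2 x).const_mul (-(1 / 2 : ℝ))).exp
    convert! h1.mul h2 using 1
    push_cast
    ring_nf
  have h0 := integral_eq_zero_of_hasDerivAt_of_integrable hd
    (((integrable_pow_mul_exp_neg_sq n).const_mul _).sub (integrable_pow_mul_exp_neg_sq (n + 2)))
    (integrable_pow_mul_exp_neg_sq (n + 1))
  rw [integral_sub ((integrable_pow_mul_exp_neg_sq n).const_mul _)
    (integrable_pow_mul_exp_neg_sq (n + 2)), integral_const_mul] at h0
  rw [integral_gaussianReal_eq, integral_gaussianReal_eq]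
  linear_combination (-(√(2 * Real.pi))⁻¹) * h0

lemma integrable_pow_gaussianReal (n : ℕ) :
    Integrable (fun x : ℝ => x ^ n) (gaussianReal 0 1) := by
  have h := (memLp_id_gaussianReal (μ := 0) (v := 1) (n : NNReal)).integrable_norm_pow' 
  have h2 : AEStronglyMeasurable (fun x : ℝ => x ^ n) (gaussianReal 0 1) := by fun_prop
  refine (integrable_norm_iff h2).1 ?_
  simpa only [norm_pow, id] using h

/-- The centred square `x² - 1` has all moments under the standard Gaussian law. -/
lemma integrable_sq_sub_one_pow (n : ℕ) :
    Integrable (fun x : ℝ => (x ^ 2 - 1) ^ n) (gaussianReal 0 1) := by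
  simp only [sub_eq_add_neg, add_pow, ← pow_mul]
  exact integrable_finsetSum _ fun i _ =>
    ((integrable_pow_gaussianReal _).mul_const _).mul_const _

lemma gaussianReal_even_moments :
    ∫ x, x ^ 2 ∂(gaussianReal 0 1) = 1 ∧ ∫ x, x ^ 4 ∂(gaussianReal 0 1) = 3 ∧
    ∫ x, x ^ 6 ∂(gaussianReal 0 1) = 15 ∧ ∫ x, x ^ 8 ∂(gaussianReal 0 1) = 105 := by
  have h0 : ∫ x : ℝ, x ^ 0 ∂(gaussianReal 0 1) = 1 := by simp
  have h2 := integral_pow_gaussianReal_step 0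
  have h4 := integral_pow_gaussianReal_step 2
  have h6 := integral_pow_gaussianReal_step 4
  have h8 := integral_pow_gaussianReal_step 6
  norm_num at h0 h2 h4 h6 h8
  refine ⟨by linarith, by linarith, by linarith, by linarith⟩

lemma gaussianReal_sq_sub_one_moments :
    ∫ x, (x ^ 2 - 1) ∂(gaussianReal 0 1) = 0 ∧ ∫ x, (x ^ 2 - 1) ^ 2 ∂(gaussianReal 0 1) = 2 ∧
    ∫ x, (x ^ 2 - 1) ^ 4 ∂(gaussianReal 0 1) = 60 := by
  obtain ⟨h2, h4, h6, h8⟩ := gaussianReal_even_moments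
  have I := integrable_pow_gaussianReal
  refine ⟨?_, ?_, ?_⟩
  · rw [integral_sub (I 2) (integrable_const _), h2]
    simp
  · have e : ∀ x : ℝ, (x ^ 2 - 1) ^ 2 = x ^ 4 + (-2) * x ^ 2 + 1 := fun x => by ring
    simp only [e]
    rw [integral_add ((I 4).fun_add ((I 2).const_mul _)) (integrable_const _),
      integral_add (I 4) ((I 2).const_mul _), integral_const_mul, h2, h4]
    simp; norm_num
  · have e : ∀ x : ℝ, (x ^ 2 - 1) ^ 4 = x ^ 8 + (-4) * x ^ 6 + 6 * x ^ 4 + (-4) * x ^ 2 + 1 :=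
      fun x => by ring
    simp only [e]
    have J8 := (I 8).fun_add ((I 6).const_mul (-4))
    have J4 := J8.fun_add ((I 4).const_mul 6)
    have J2 := J4.fun_add ((I 2).const_mul (-4))
    rw [integral_add J2 (integrable_const _), integral_add J4 ((I 2).const_mul _),
      integral_add J8 ((I 4).const_mul _), integral_add (I 8) ((I 6).const_mul _),
      integral_const_mul, integral_const_mul, integral_const_mul, h2, h4, h6, h8]
    simp; norm_num

lemma integral_exp_sq_div_three_gaussianReal :
    Integrable (fun x : ℝ => Real.exp (x ^ 2 / 3)) (gaussianReal 0 1) ∧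
    ∫ x, Real.exp (x ^ 2 / 3) ∂(gaussianReal 0 1) = √3 := by
  have hv : ∫ x, Real.exp (x ^ 2 / 3) ∂(gaussianReal 0 1) = √3 := by
    rw [integral_gaussianReal_eq]
    have e : ∀ x : ℝ, Real.exp (x ^ 2 / 3) * Real.exp (-(1 / 2) * x ^ 2)
        = Real.exp (-(1 / 6) * x ^ 2) := fun x => by
      rw [← Real.exp_add]; congr 1; ring
    simp only [e]
    rw [integral_gaussian, ← Real.sqrt_inv, ← Real.sqrt_mul (by positivity)]
    congr 1
    field_simp
    norm_num
  refine ⟨?_, hv⟩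
  -- The integral of a non-integrable function is `0` by convention, so the nonzero value `√3`
  -- already forces integrability.
  by_contra h
  rw [integral_undef h] at hv
  have : (0 : ℝ) < √3 := by positivity
  linarith

/-- Second and fourth moments of a linear combination of independent centred variables. -/
lemma moments_sum_of_iIndepFun {Ω ι : Type*} [MeasurableSpace Ω] {ν : Measure Ω}
    [IsProbabilityMeasure ν] {V : ι → Ω → ℝ} (hm : ∀ i, Measurable (V i))
    (hV : iIndepFun V ν) (hint : ∀ i (n : ℕ), Integrable (fun ω => V i ω ^ n) ν)
    (h1 : ∀ i, ∫ ω, V i ω ∂ν = 0) (h2 : ∀ i, ∫ ω, V i ω ^ 2 ∂ν = 2)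
    (h4 : ∀ i, ∫ ω, V i ω ^ 4 ∂ν = 60) (b : ι → ℝ) (s : Finset ι) :
    (∀ n : ℕ, Integrable (fun ω => (∑ i ∈ s, b i * V i ω) ^ n) ν) ∧
    ∫ ω, ∑ i ∈ s, b i * V i ω ∂ν = 0 ∧
    ∫ ω, (∑ i ∈ s, b i * V i ω) ^ 2 ∂ν = 2 * ∑ i ∈ s, b i ^ 2 ∧
    ∫ ω, (∑ i ∈ s, b i * V i ω) ^ 4 ∂ν ≤ 60 * (∑ i ∈ s, b i ^ 2) ^ 2 := by
  classical
  induction s using Finset.induction_on with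
  | empty =>
    refine ⟨fun n => ?_, by simp, by simp, by simp⟩
    simp
  | insert j s hj ih =>
    obtain ⟨I', m1, m2, m4⟩ := ih
    set X : Ω → ℝ := fun ω => b j * V j ω with hX
    set Y : Ω → ℝ := fun ω => ∑ i ∈ s, b i * V i ω with hY
    have I : ∀ n : ℕ, Integrable (fun ω => Y ω ^ n) ν := I'
    have IX : ∀ n : ℕ, Integrable (fun ω => X ω ^ n) ν := fun n => by
      simp only [hX, mul_pow]
      exact (hint j n).const_mul _
    have hXm : Measurable X := (hm j).const_mul _
    have hYm : Measurable Y := Finset.measurable_fun_sum _ fun i _ => (hm i).const_mul _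
    have hind : IndepFun X Y ν := by
      have h' : iIndepFun (fun i ω => b i * V i ω) ν :=
        hV.comp (fun i x => b i * x) (fun i => measurable_const_mul _)
      have := (h'.indepFun_finsetSum_of_notMem (fun i => (hm i).const_mul _) hj).symm
      convert this using 1
      ext ω; simp [hY]
    have hpow : ∀ m n : ℕ, IndepFun (fun ω => X ω ^ m) (fun ω => Y ω ^ n) ν := fun m n =>
      hind.comp (φ := fun x => x ^ m) (ψ := fun x => x ^ n) (by fun_prop) (by fun_prop)
    have Imix : ∀ m n : ℕ, Integrable (fun ω => X ω ^ m * Y ω ^ n) ν := fun m n =>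
      (hpow m n).integrable_mul (IX m) (I n)
    have Emix : ∀ m n : ℕ, ∫ ω, X ω ^ m * Y ω ^ n ∂ν
        = (∫ ω, X ω ^ m ∂ν) * ∫ ω, Y ω ^ n ∂ν := fun m n =>
      (hpow m n).integral_fun_mul_eq_mul_integral (IX m).aestronglyMeasurable
        (I n).aestronglyMeasurable
    have x1 : ∫ ω, X ω ^ 1 ∂ν = 0 := by simp [hX, integral_const_mul, h1]
    have y1 : ∫ ω, Y ω ^ 1 ∂ν = 0 := by simpa using m1
    have x2 : ∫ ω, X ω ^ 2 ∂ν = 2 * b j ^ 2 := by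
      simp only [hX, mul_pow, integral_const_mul, h2]; ring
    have x4 : ∫ ω, X ω ^ 4 ∂ν = 60 * b j ^ 4 := by
      simp only [hX, mul_pow, integral_const_mul, h4]; ring
    have hs : ∀ ω, ∑ i ∈ insert j s, b i * V i ω = X ω + Y ω := fun ω =>
      Finset.sum_insert hj
    simp only [hs, Finset.sum_insert hj]
    refine ⟨fun n => ?_, ?_, ?_, ?_⟩
    · simp only [add_pow]
      exact integrable_finsetSum _ fun i _ => (Imix _ _).mul_const _
    · have a1 : Integrable X ν := by simpa using IX 1
      have a2 : Integrable Y ν := by simpa using I 1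
      rw [integral_add a1 a2, m1, add_zero]
      simpa using x1
    · have e : ∀ ω, (X ω + Y ω) ^ 2 = X ω ^ 2 + 2 * (X ω ^ 1 * Y ω ^ 1) + Y ω ^ 2 :=
        fun ω => by ring
      simp only [e]
      rw [integral_add ((IX 2).fun_add ((Imix 1 1).const_mul 2)) (I 2),
        integral_add (IX 2) ((Imix 1 1).const_mul 2), integral_const_mul, Emix, x1, x2, m2]
      ring
    · have e : ∀ ω, (X ω + Y ω) ^ 4 = X ω ^ 4 + 4 * (X ω ^ 3 * Y ω ^ 1)
          + 6 * (X ω ^ 2 * Y ω ^ 2) + 4 * (X ω ^ 1 * Y ω ^ 3) + Y ω ^ 4 :=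
        fun ω => by ring
      simp only [e]
      rw [integral_add ((((IX 4).fun_add ((Imix 3 1).const_mul 4)).fun_add
          ((Imix 2 2).const_mul 6)).fun_add ((Imix 1 3).const_mul 4)) (I 4),
        integral_add (((IX 4).fun_add ((Imix 3 1).const_mul 4)).fun_add ((Imix 2 2).const_mul 6))
          ((Imix 1 3).const_mul 4),
        integral_add ((IX 4).fun_add ((Imix 3 1).const_mul 4)) ((Imix 2 2).const_mul 6),
        integral_add (IX 4) ((Imix 3 1).const_mul 4), integral_const_mul, integral_const_mul,
        integral_const_mul, Emix, Emix, Emix, x1, y1, x2, x4, m2]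
      have hb : 0 ≤ b j ^ 2 := sq_nonneg _
      have hsum : 0 ≤ ∑ i ∈ s, b i ^ 2 := Finset.sum_nonneg fun i _ => sq_nonneg _
      -- The mixed term is `6 · 2 · 2 = 24` times `b j ^ 2 * ∑ b i ^ 2`, below the `120` that
      -- expanding the square on the right provides.
      nlinarith [mul_nonneg hb hsum]

end GaussianMoments

/-! ### Frobenius inner product and quadratic forms. -/

section Frobenius

variable {d : ℕ}

/-- The Frobenius inner product `⟨A, B⟩ = tr(A Bᵀ)`. -/
def frob (A B : Mat d) : ℝ := ∑ i, ∑ j, A i j * B i j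

lemma frob_self (A : Mat d) : frob A A = ‖A‖ ^ 2 := by
  have h0 : 0 ≤ ∑ i, ∑ j, A i j ^ 2 :=
    Finset.sum_nonneg fun i _ => Finset.sum_nonneg fun j _ => sq_nonneg _
  rw [Matrix.frobenius_norm_def, ← Real.sqrt_eq_rpow]
  simp only [Real.norm_eq_abs, Real.rpow_two, sq_abs]
  rw [Real.sq_sqrt h0, frob]
  simp only [sq]

lemma frob_comm (A B : Mat d) : frob A B = frob B A := by
  simp only [frob, mul_comm]

lemma frob_add_left (A B C : Mat d) : frob (A + B) C = frob A C + frob B C := by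
  simp only [frob, Matrix.add_apply, add_mul, Finset.sum_add_distrib]

lemma frob_smul_left (c : ℝ) (A B : Mat d) : frob (c • A) B = c * frob A B := by
  simp only [frob, Matrix.smul_apply, smul_eq_mul, Finset.mul_sum, mul_assoc]

lemma frob_sub_left (A B C : Mat d) : frob (A - B) C = frob A C - frob B C := by
  simp only [frob, Matrix.sub_apply, sub_mul, Finset.sum_sub_distrib]

lemma frob_add_right (A B C : Mat d) : frob A (B + C) = frob A B + frob A C := by
  rw [frob_comm, frob_add_left, frob_comm B, frob_comm C]

lemma frob_sub_right (A B C : Mat d) : frob A (B - C) = frob A B - frob A C := by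
  rw [frob_comm, frob_sub_left, frob_comm B, frob_comm C]

lemma frob_smul_right (c : ℝ) (A B : Mat d) : frob A (c • B) = c * frob A B := by
  rw [frob_comm, frob_smul_left, frob_comm]

lemma norm_add_sq_frob (A B : Mat d) : ‖A + B‖ ^ 2 = ‖A‖ ^ 2 + 2 * frob A B + ‖B‖ ^ 2 := by
  simp only [← frob_self, frob_add_left, frob_add_right, frob_comm B A]
  ring

lemma norm_sub_sq_frob (A B : Mat d) : ‖A - B‖ ^ 2 = ‖A‖ ^ 2 - 2 * frob A B + ‖B‖ ^ 2 := by
  simp only [← frob_self, frob_sub_left, frob_sub_right, frob_comm B A]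
  ring

lemma frob_le_norm_mul_norm (A B : Mat d) : |frob A B| ≤ ‖A‖ * ‖B‖ := by
  refine abs_le_of_sq_le_sq ?_ (by positivity)
  rw [mul_pow, ← frob_self, ← frob_self]
  have h := Finset.sum_mul_sq_le_sq_mul_sq (Finset.univ : Finset (Fin d × Fin d))
    (fun p => A p.1 p.2) (fun p => B p.1 p.2)
  simpa only [frob, ← sq, ← Finset.univ_product_univ, Finset.sum_product] using h

lemma frob_eq_trace (A B : Mat d) : frob A B = (A * B.transpose).trace := by
  simp [frob, Matrix.trace, Matrix.mul_apply]

lemma frob_one_right (A : Mat d) : frob A 1 = A.trace := by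
  simp [frob_eq_trace]

lemma norm_one_sq : ‖(1 : Mat d)‖ ^ 2 = d := by
  rw [← frob_self, frob_one_right]; simp

/-- The quadratic form `uᵀ B u`. -/
noncomputable def quad (B : Mat d) (u : Vec d) : ℝ := inner ℝ u (app B u)

lemma inner_eq_sum (u v : Vec d) : inner ℝ u v = ∑ i, u i * v i := by
  simp [PiLp.inner_apply, mul_comm]

lemma app_apply (B : Mat d) (u : Vec d) (i : Fin d) : app B u i = ∑ j, B i j * u j := rfl

lemma inner_app_transpose (B : Mat d) (u v : Vec d) :
    inner ℝ u (app B v) = inner ℝ (app B.transpose u) v := by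
  simp only [inner_eq_sum, app_apply, Finset.mul_sum, Finset.sum_mul, Matrix.transpose_apply]
  rw [Finset.sum_comm]
  exact Finset.sum_congr rfl fun i _ => Finset.sum_congr rfl fun j _ => by ring

lemma quad_eq_frob_outer (B : Mat d) (u : Vec d) : quad B u = frob B (outer u) := by
  simp only [quad, inner_eq_sum, app_apply, frob, outer, Matrix.vecMulVec_apply, Finset.mul_sum]
  exact Finset.sum_congr rfl fun i _ => Finset.sum_congr rfl fun j _ => by ring

lemma quad_one (u : Vec d) : quad 1 u = ‖u‖ ^ 2 := by
  rw [quad, app, Matrix.one_mulVec, WithLp.toLp_ofLp, real_inner_self_eq_norm_sq]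

lemma norm_outer (u : Vec d) : ‖outer u‖ = ‖u‖ ^ 2 := by
  have h : ‖outer u‖ ^ 2 = (‖u‖ ^ 2) ^ 2 := by
    rw [← frob_self, ← quad_eq_frob_outer, ← real_inner_self_eq_norm_sq, quad]
    simp only [inner_eq_sum, app_apply, outer, Matrix.vecMulVec_apply, Finset.mul_sum,
      sq, Finset.sum_mul]
    exact Finset.sum_congr rfl fun i _ => Finset.sum_congr rfl fun j _ => by ring
  exact (pow_left_inj₀ (norm_nonneg _) (by positivity) two_ne_zero).1 h

lemma quad_add (A B : Mat d) (u : Vec d) : quad (A + B) u = quad A u + quad B u := by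
  simp only [quad_eq_frob_outer, frob_add_left]

lemma quad_sub (A B : Mat d) (u : Vec d) : quad (A - B) u = quad A u - quad B u := by
  simp only [quad_eq_frob_outer, frob_sub_left]

lemma quad_smul (c : ℝ) (B : Mat d) (u : Vec d) : quad (c • B) u = c * quad B u := by
  simp only [quad_eq_frob_outer, frob_smul_left]

@[fun_prop]
lemma continuous_app : Continuous fun p : Mat d × Vec d => app p.1 p.2 := by
  unfold app
  fun_prop

lemma continuous_quad (B : Mat d) : Continuous (quad B) := by
  unfold quad
  exact continuous_id.inner (continuous_app.comp (continuous_const.prodMk continuous_id))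

/-- Simultaneous diagonalization of the quadratic form, the trace and the Frobenius norm of a
symmetric matrix. -/
lemma exists_diagonalization {B : Mat d} (hB : B.IsSymm) :
    ∃ (e : OrthonormalBasis (Fin d) ℝ (Vec d)) (c : Fin d → ℝ),
      (∀ j, app B (e j) = c j • e j) ∧ (∀ u, quad B u = ∑ j, c j * inner ℝ (e j) u ^ 2) ∧
      B.trace = ∑ j, c j ∧
      ‖B‖ ^ 2 = ∑ j, c j ^ 2 := by
  have hH : B.IsHermitian := by
    rw [Matrix.IsHermitian, Matrix.conjTranspose_eq_transpose_of_trivial]; exact hB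
  have he : ∀ j, app B (hH.eigenvectorBasis j) = hH.eigenvalues j • hH.eigenvectorBasis j := by
    intro j
    rw [app, hH.mulVec_eigenvectorBasis j]
    rfl
  refine ⟨hH.eigenvectorBasis, hH.eigenvalues, he, fun u => ?_, ?_, ?_⟩
  · rw [quad, ← hH.eigenvectorBasis.sum_inner_mul_inner]
    refine Finset.sum_congr rfl fun j _ => ?_
    rw [inner_app_transpose, hB.eq, he, real_inner_smul_left,
      real_inner_comm (hH.eigenvectorBasis j) u]
    ring
  · simpa using hH.trace_eq_sum_eigenvalues
  · rw [← frob_self, frob_eq_trace, hB.eq]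
    conv_lhs => rw [hH.spectral_theorem]
    rw [← map_mul, Matrix.diagonal_mul_diagonal, Unitary.conjStarAlgAut_apply,
      Matrix.trace_mul_cycle, Unitary.coe_star_mul_self, one_mul, Matrix.trace_diagonal]
    simp [sq]

end Frobenius

/-! ### Moments and tails of Gaussian quadratic forms. -/

section Chaos

variable {d : ℕ}

/-- The centred quadratic form `uᵀ B u - tr B`. -/
noncomputable def chaos (B : Mat d) (u : Vec d) : ℝ := quad B u - B.trace

lemma continuous_chaos (B : Mat d) : Continuous (chaos B) :=
  (continuous_quad B).sub continuous_const

lemma chaos_add (A B : Mat d) (u : Vec d) : chaos (A + B) u = chaos A u + chaos B u := by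
  simp only [chaos, quad_add, Matrix.trace_add]; ring

lemma chaos_sub (A B : Mat d) (u : Vec d) : chaos (A - B) u = chaos A u - chaos B u := by
  simp only [chaos, quad_sub, Matrix.trace_sub]; ring

lemma integral_stdGaussian_eq_pi (e : OrthonormalBasis (Fin d) ℝ (Vec d)) (g : Vec d → ℝ)
    (hg : Measurable g) :
    ∫ u, g u ∂(stdGaussian (Vec d))
        = ∫ x : Fin d → ℝ, g (∑ i, x i • e i) ∂(Measure.pi fun _ => gaussianReal 0 1) ∧
    (Integrable g (stdGaussian (Vec d)) ↔
      Integrable (fun x : Fin d → ℝ => g (∑ i, x i • e i))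
        (Measure.pi fun _ => gaussianReal 0 1)) := by
  have hm : Measurable fun x : Fin d → ℝ => ∑ i, x i • e i := by fun_prop
  rw [stdGaussian_eq_map_pi_orthonormalBasis e]
  exact ⟨integral_map hm.aemeasurable hg.aestronglyMeasurable,
    integrable_map_measure hg.aestronglyMeasurable hm.aemeasurable⟩

lemma inner_basis_sum (e : OrthonormalBasis (Fin d) ℝ (Vec d)) (x : Fin d → ℝ) (j : Fin d) :
    inner ℝ (e j) (∑ i, x i • e i) = x j := by
  simpa using e.orthonormal.inner_right_fintype x j

/-- In an eigenbasis of `B` the Gaussian coordinates stay independent, and `chaos B` becomes `∑ c_j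
(x_j² - 1)`. -/
lemma chaos_moments {B : Mat d} (hB : B.IsSymm) :
    (∀ n : ℕ, Integrable (fun u => chaos B u ^ n) (stdGaussian (Vec d))) ∧
    ∫ u, chaos B u ∂(stdGaussian (Vec d)) = 0 ∧
    ∫ u, chaos B u ^ 2 ∂(stdGaussian (Vec d)) = 2 * ‖B‖ ^ 2 ∧
    ∫ u, chaos B u ^ 4 ∂(stdGaussian (Vec d)) ≤ 60 * (‖B‖ ^ 2) ^ 2 := by
  obtain ⟨e, c, -, hq, ht, hn⟩ := exists_diagonalization hB
  have hc : ∀ x : Fin d → ℝ, chaos B (∑ i, x i • e i) = ∑ j, c j * (x j ^ 2 - 1) := by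
    intro x
    rw [chaos, hq, ht]
    simp only [inner_basis_sum, mul_sub, mul_one, Finset.sum_sub_distrib]
  have hind : iIndepFun (fun (i : Fin d) (x : Fin d → ℝ) => x i ^ 2 - 1)
      (Measure.pi fun _ => gaussianReal 0 1) :=
    iIndepFun_pi (X := fun _ y => y ^ 2 - 1) fun i => by fun_prop
  have heval : ∀ (i : Fin d), MeasurePreserving (Function.eval i)
      (Measure.pi fun _ : Fin d => gaussianReal 0 1) (gaussianReal 0 1) := fun i =>
    measurePreserving_eval _ i
  have hI : ∀ (i : Fin d) (g : ℝ → ℝ), Measurable g →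
      ∫ x : Fin d → ℝ, g (x i) ∂(Measure.pi fun _ => gaussianReal 0 1)
        = ∫ y, g y ∂(gaussianReal 0 1) := by
    intro i g hg
    have h := integral_map (μ := Measure.pi fun _ : Fin d => gaussianReal 0 1)
      (heval i).measurable.aemeasurable (f := g) hg.aestronglyMeasurable
    rw [(heval i).map_eq] at h
    exact h.symm
  obtain ⟨w1, w2, w4⟩ := gaussianReal_sq_sub_one_moments
  obtain ⟨r0, r1, r2, r4⟩ := moments_sum_of_iIndepFun (fun i => by fun_prop) hind
    (fun i n => (heval i).integrable_comp_of_integrable (integrable_sq_sub_one_pow n))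
    (fun i => (hI i (fun y => y ^ 2 - 1) (by fun_prop)).trans w1)
    (fun i => (hI i (fun y => (y ^ 2 - 1) ^ 2) (by fun_prop)).trans w2)
    (fun i => (hI i (fun y => (y ^ 2 - 1) ^ 4) (by fun_prop)).trans w4) c Finset.univ
  have hm : ∀ n : ℕ, Measurable fun u => chaos B u ^ n := fun n =>
    (continuous_chaos B).measurable.pow_const n
  refine ⟨fun n => ?_, ?_, ?_, ?_⟩
  · rw [(integral_stdGaussian_eq_pi e _ (hm n)).2]
    simpa only [hc] using r0 n
  · rw [(integral_stdGaussian_eq_pi e _ (continuous_chaos B).measurable).1]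
    simpa only [hc] using r1
  · rw [(integral_stdGaussian_eq_pi e _ (hm 2)).1, hn]
    simpa only [hc] using r2
  · rw [(integral_stdGaussian_eq_pi e _ (hm 4)).1, hn]
    simpa only [hc] using r4

/-- Polarization of the second moment. -/
lemma chaos_mul_chaos {A B : Mat d} (hA : A.IsSymm) (hB : B.IsSymm) :
    Integrable (fun u => chaos A u * chaos B u) (stdGaussian (Vec d)) ∧
    ∫ u, chaos A u * chaos B u ∂(stdGaussian (Vec d)) = 2 * frob A B := by
  obtain ⟨p0, -, p2, -⟩ := chaos_moments (hA.add hB)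
  obtain ⟨m0, -, m2, -⟩ := chaos_moments (hA.sub hB)
  have e : ∀ u, chaos A u * chaos B u
      = (1 / 4) * (chaos (A + B) u ^ 2 - chaos (A - B) u ^ 2) := fun u => by
    rw [chaos_add, chaos_sub]; ring
  simp only [e]
  refine ⟨((p0 2).sub (m0 2)).const_mul _, ?_⟩
  rw [integral_const_mul, integral_sub (p0 2) (m0 2), p2, m2, norm_add_sq_frob, norm_sub_sq_frob]
  ring

/-- The identity behind the unbiasedness of `G̃`: the trace part of `quad A` is constant and the
chaos has mean zero. -/
lemma quad_mul_chaos {A B : Mat d} (hA : A.IsSymm) (hB : B.IsSymm) :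
    Integrable (fun u => quad A u * chaos B u) (stdGaussian (Vec d)) ∧
    ∫ u, quad A u * chaos B u ∂(stdGaussian (Vec d)) = 2 * frob A B := by
  obtain ⟨b0, b1, -, -⟩ := chaos_moments hB
  obtain ⟨p0, p1⟩ := chaos_mul_chaos hA hB
  have b0' : Integrable (chaos B) (stdGaussian (Vec d)) := by simpa using b0 1
  have e : ∀ u, quad A u * chaos B u = chaos A u * chaos B u + A.trace * chaos B u := fun u => by
    simp only [chaos]; ring
  simp only [e]
  refine ⟨p0.fun_add (b0'.const_mul _), ?_⟩
  rw [integral_add p0 (b0'.const_mul _), integral_const_mul, p1, b1]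
  ring

/-- `|u|⁴ (uᵀ B u - tr B)²` is dominated by an integrable function of small integral. -/
lemma exists_dominating_norm_four_mul_chaos_sq {B : Mat d} (hB : B.IsSymm) :
    ∃ D : Vec d → ℝ, Integrable D (stdGaussian (Vec d)) ∧
      (∀ u, ‖u‖ ^ 4 * chaos B u ^ 2 ≤ D u) ∧
      ∫ u, D u ∂(stdGaussian (Vec d)) ≤ (4 * d ^ 2 + 120 * d) * ‖B‖ ^ 2 := by
  rcases eq_or_ne B 0 with rfl | hB0
  · refine ⟨fun _ => 0, integrable_zero _ _ _, fun u => ?_, by simp⟩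
    simp [chaos, quad_eq_frob_outer, frob]
  have hd : 0 < d := by
    rcases Nat.eq_zero_or_pos d with rfl | h
    · exact absurd (Subsingleton.elim B 0) hB0
    · exact h
  have hdR : (0 : ℝ) < d := by exact_mod_cast hd
  have hBn : 0 < ‖B‖ ^ 2 := by positivity
  obtain ⟨b0, -, b2, b4⟩ := chaos_moments hB
  obtain ⟨i0, -, -, i4⟩ := chaos_moments (d := d) (B := 1) Matrix.isSymm_one
  -- This weight makes the two fourth moments in `2 S² Q² ≤ η S⁴ + η⁻¹ Q⁴` contribute equally, `60 d
  -- ‖B‖²` each.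
  set η : ℝ := ‖B‖ ^ 2 / d with hη
  have hηp : 0 < η := by positivity
  have J1 := (b0 2).const_mul (2 * (d : ℝ) ^ 2)
  have J2 := (i0 4).const_mul η
  have J3 := (b0 4).const_mul η⁻¹
  refine ⟨fun u => 2 * (d : ℝ) ^ 2 * chaos B u ^ 2 + η * chaos 1 u ^ 4 + η⁻¹ * chaos B u ^ 4,
    (J1.fun_add J2).fun_add J3, fun u => ?_, ?_⟩
  · have hu : ‖u‖ ^ 2 = d + chaos 1 u := by
      rw [chaos, quad_one]; simp
    rw [show ‖u‖ ^ 4 = (‖u‖ ^ 2) ^ 2 by ring, hu]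
    set S := chaos 1 u
    set Q := chaos B u
    have h1 : (d + S) ^ 2 * Q ^ 2 ≤ (2 * d ^ 2 + 2 * S ^ 2) * Q ^ 2 :=
      mul_le_mul_of_nonneg_right (by nlinarith [sq_nonneg ((d : ℝ) - S)]) (sq_nonneg _)
    have h2 : 2 * S ^ 2 * Q ^ 2 ≤ η * S ^ 4 + η⁻¹ * Q ^ 4 := by
      have h3 : 0 ≤ η⁻¹ * (η * S ^ 2 - Q ^ 2) ^ 2 := by positivity
      have h4 : η⁻¹ * (η * S ^ 2 - Q ^ 2) ^ 2
          = η * S ^ 4 + η⁻¹ * Q ^ 4 - 2 * S ^ 2 * Q ^ 2 := by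
        field_simp
        ring
      linarith
    linarith
  · rw [integral_add (J1.fun_add J2) J3, integral_add J1 J2, integral_const_mul,
      integral_const_mul, integral_const_mul, b2]
    rw [norm_one_sq] at i4
    have h2 := mul_le_mul_of_nonneg_left i4 hηp.le
    have h3 := mul_le_mul_of_nonneg_left b4 (inv_pos.2 hηp).le
    have h4 : η * (60 * (d : ℝ) ^ 2) = 60 * d * ‖B‖ ^ 2 := by rw [hη]; field_simp
    have h5 : η⁻¹ * (60 * (‖B‖ ^ 2) ^ 2) = 60 * d * ‖B‖ ^ 2 := by rw [hη]; field_simp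
    linarith

/-- A Laurent–Massart type bound for the squared norm of a standard Gaussian vector. -/
lemma stdGaussian_norm_sq_tail (t : ℝ) :
    (stdGaussian (Vec d)).real {u | 2 * (d : ℝ) + 3 * t ≤ ‖u‖ ^ 2} ≤ Real.exp (-t) := by
  obtain ⟨I3, v3⟩ := integral_exp_sq_div_three_gaussianReal
  let e := EuclideanSpace.basisFun (Fin d) ℝ
  have hm : Measurable fun u : Vec d => Real.exp (1 / 3 * ‖u‖ ^ 2) := by fun_prop
  have hx : ∀ x : Fin d → ℝ, Real.exp (1 / 3 * ‖∑ i, x i • e i‖ ^ 2)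
      = ∏ i, Real.exp (x i ^ 2 / 3) := by
    intro x
    rw [← e.sum_sq_norm_inner_right, ← Real.exp_sum, Finset.mul_sum]
    simp only [inner_basis_sum, Real.norm_eq_abs, sq_abs]
    congr 1
    exact Finset.sum_congr rfl fun i _ => by ring
  have hint : Integrable (fun u : Vec d => Real.exp (1 / 3 * ‖u‖ ^ 2)) (stdGaussian (Vec d)) := by
    rw [(integral_stdGaussian_eq_pi e _ hm).2]
    simp only [hx]
    exact Integrable.fintype_prod fun i => I3
  -- Chernoff with parameter `1/3`: the moment generating function is `(√3)^d`, and `√3 ≤ e^{2/3}`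
  -- lets the shift `2d` absorb it.
  have h := measure_ge_le_exp_mul_mgf (μ := stdGaussian (Vec d)) (X := fun u => ‖u‖ ^ 2)
    (t := 1 / 3) (2 * (d : ℝ) + 3 * t) (by norm_num) hint
  refine h.trans ?_
  rw [mgf, (integral_stdGaussian_eq_pi e _ hm).1]
  simp only [hx]
  rw [integral_fintype_prod_eq_pow (fun y : ℝ => Real.exp (y ^ 2 / 3)), v3, Fintype.card_fin]
  have hexp : Real.exp (-(1 / 3) * (2 * (d : ℝ) + 3 * t))
      = Real.exp (-t) * Real.exp (-(2 / 3)) ^ d := by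
    rw [← Real.exp_nat_mul, ← Real.exp_add]; congr 1; ring
  rw [hexp, mul_assoc, ← mul_pow]
  refine mul_le_of_le_one_right (Real.exp_pos _).le (pow_le_one₀ (by positivity) ?_)
  have hs : √3 ≤ 7 / 4 := by
    rw [Real.sqrt_le_left (by norm_num)]; norm_num
  have he : 7 / 4 ≤ Real.exp (2 / 3) := by
    have := Real.quadratic_le_exp_of_nonneg (x := 2 / 3) (by norm_num)
    norm_num at this ⊢
    linarith
  rw [Real.exp_neg, inv_mul_le_one₀ (Real.exp_pos _)]
  linarith

end Chaos

/-! ### Geometry of `𝒮'`, its projection and the matrix square root. -/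

section Geometry

variable {d : ℕ}

lemma isSymm_of_posSemidef {A : Mat d} (hA : A.PosSemidef) : A.IsSymm := by
  have h := hA.isHermitian
  rwa [Matrix.IsHermitian, Matrix.conjTranspose_eq_transpose_of_trivial] at h

lemma frob_self_mul_nonneg {P : Mat d} (hP : P.PosSemidef) (Y : Mat d) : 0 ≤ frob Y (P * Y) := by
  have h := (hP.conjTranspose_mul_mul_same Y).trace_nonneg
  rwa [Matrix.conjTranspose_eq_transpose_of_trivial, mul_assoc, Matrix.trace_mul_comm,
    ← frob_eq_trace, frob_comm] at h

lemma frob_transpose (A B : Mat d) : frob A.transpose B.transpose = frob A B := by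
  simp only [frob, Matrix.transpose_apply]
  exact Finset.sum_comm

lemma norm_transpose_eq (A : Mat d) : ‖A.transpose‖ = ‖A‖ := by
  rw [← pow_left_inj₀ (norm_nonneg _) (norm_nonneg _) two_ne_zero, ← frob_self, ← frob_self,
    frob_transpose]

lemma frob_self_mul_right_nonneg {P : Mat d} (hP : P.PosSemidef) (Y : Mat d) :
    0 ≤ frob Y (Y * P) := by
  have h := frob_self_mul_nonneg hP Y.transpose
  rwa [← (isSymm_of_posSemidef hP).eq, ← Matrix.transpose_mul, frob_transpose] at h

/-- Left multiplication by a symmetric square root of `X ≼ ζ I`. -/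
lemma norm_mul_sq_le {R X : Mat d} {ζ : ℝ} (hR : R.IsSymm) (hRR : R * R = X)
    (hX : X ≤ ζ • (1 : Mat d)) (Y : Mat d) : ‖R * Y‖ ^ 2 ≤ ζ * ‖Y‖ ^ 2 := by
  have h := frob_self_mul_nonneg (Matrix.le_iff.1 hX) Y
  rw [sub_mul, Matrix.smul_mul, one_mul, frob_sub_right, frob_smul_right, frob_self] at h
  have e : ‖R * Y‖ ^ 2 = frob Y (X * Y) := by
    rw [← frob_self, frob_eq_trace, frob_eq_trace, Matrix.transpose_mul, Matrix.transpose_mul,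
      ← hRR, Matrix.transpose_mul, hR.eq, ← mul_assoc, Matrix.trace_mul_comm]
    simp only [mul_assoc]
    rw [Matrix.trace_mul_comm]
    simp only [mul_assoc]
    rw [Matrix.trace_mul_comm]
    simp only [mul_assoc]
  linarith

lemma norm_conj_le {R X : Mat d} {ζ : ℝ} (hR : R.IsSymm) (hRR : R * R = X) (hζ : 0 ≤ ζ)
    (hX : X ≤ ζ • (1 : Mat d)) (Y : Mat d) : ‖R * Y * R‖ ≤ ζ * ‖Y‖ := by
  refine (sq_le_sq₀ (norm_nonneg _) (by positivity)).1 ?_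
  have h1 := norm_mul_sq_le hR hRR hX Y
  -- Multiplication by `R` on the right is multiplication on the left after a transpose.
  have h2 := norm_mul_sq_le hR hRR hX (R * Y).transpose
  rw [norm_transpose_eq] at h2
  have e : ‖R * Y * R‖ = ‖R * (R * Y).transpose‖ := by
    rw [← norm_transpose_eq, Matrix.transpose_mul, hR.eq]
  rw [e]
  nlinarith

lemma abs_chaos_le (B : Mat d) (u : Vec d) : |chaos B u| ≤ (‖u‖ ^ 2 + √d) * ‖B‖ := by
  have h1 := frob_le_norm_mul_norm B (outer u)
  have h2 := frob_le_norm_mul_norm B 1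
  have h3 : ‖(1 : Mat d)‖ = √d := by
    rw [← norm_one_sq, Real.sqrt_sq (norm_nonneg _)]
  rw [norm_outer, ← quad_eq_frob_outer] at h1
  rw [frob_one_right, h3] at h2
  have h4 := abs_sub (quad B u) B.trace
  rw [chaos]
  linarith

variable {τ ζ : ℝ}

lemma precSet_isSymm (hτ : 0 < τ) (hτζ : τ ≤ ζ) {X : Mat d} (hX : X ∈ precSet d τ ζ) :
    X.IsSymm := by
  have h := isSymm_of_posSemidef (Matrix.le_iff.1 ((mem_precSet_iff hτ hτζ X).1 hX).1)
  have h2 := h.add ((Matrix.isSymm_one (n := Fin d) (α := ℝ)).smul τ)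
  simpa using h2

lemma precSet_posDef (hτ : 0 < τ) (hτζ : τ ≤ ζ) {X : Mat d} (hX : X ∈ precSet d τ ζ) :
    X.PosDef := by
  have h := ((Matrix.PosDef.one (n := Fin d) (R := ℝ)).smul hτ).add_posSemidef
    (Matrix.le_iff.1 ((mem_precSet_iff hτ hτζ X).1 hX).1)
  simpa using h

lemma inv_inv_precSet (hτ : 0 < τ) (hτζ : τ ≤ ζ) {X : Mat d} (hX : X ∈ precSet d τ ζ) :
    X⁻¹⁻¹ = X :=
  Matrix.nonsing_inv_nonsing_inv X
    ((Matrix.isUnit_iff_isUnit_det X).1 (precSet_posDef hτ hτζ hX).isUnit)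

lemma sqrt_inv_facts (hτ : 0 < τ) (hτζ : τ ≤ ζ) {X : Mat d} (hX : X ∈ precSet d τ ζ) :
    (matSqrt X⁻¹).IsSymm ∧ (matSqrt X⁻¹)⁻¹.IsSymm ∧ matSqrt X⁻¹ * matSqrt X⁻¹ = X⁻¹ ∧
    (matSqrt X⁻¹)⁻¹ * (matSqrt X⁻¹)⁻¹ = X ∧ matSqrt X⁻¹ * (matSqrt X⁻¹)⁻¹ = 1 ∧
    (matSqrt X⁻¹)⁻¹ * matSqrt X⁻¹ = 1 ∧ (matSqrt X⁻¹)⁻¹ = matSqrt X := by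
  have hP := precSet_posDef hτ hτζ hX
  have hQQ : matSqrt X⁻¹ * matSqrt X⁻¹ = X⁻¹ :=
    CFC.sqrt_mul_sqrt_self _ hP.inv.posSemidef.nonneg
  have hQ : (matSqrt X⁻¹).IsSymm :=
    isSymm_of_posSemidef (Matrix.nonneg_iff_posSemidef.1 (CFC.sqrt_nonneg X⁻¹))
  have hdet : IsUnit (matSqrt X⁻¹).det := by
    have h1 : IsUnit (X⁻¹).det := (Matrix.isUnit_iff_isUnit_det _).1 hP.inv.isUnit
    rw [← hQQ, Matrix.det_mul] at h1
    exact isUnit_of_mul_isUnit_left h1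
  refine ⟨hQ, ?_, hQQ, ?_, Matrix.mul_nonsing_inv _ hdet, Matrix.nonsing_inv_mul _ hdet, ?_⟩
  · rw [Matrix.IsSymm, Matrix.transpose_nonsing_inv, hQ.eq]
  · rw [← Matrix.mul_inv_rev, hQQ, inv_inv_precSet hτ hτζ hX]
  · rw [matSqrt, hP.inv.posSemidef.inv_sqrt, inv_inv_precSet hτ hτζ hX, matSqrt]

lemma norm_le_of_mem_precSet (hτ : 0 < τ) (hτζ : τ ≤ ζ) {X : Mat d} (hX : X ∈ precSet d τ ζ) :
    ‖X‖ ≤ ζ * √d := by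
  obtain ⟨-, hR, -, hRR, -, -, -⟩ := sqrt_inv_facts hτ hτζ hX
  have h := norm_conj_le hR hRR (hτ.le.trans hτζ) ((mem_precSet_iff hτ hτζ X).1 hX).2 1
  have h3 : ‖(1 : Mat d)‖ = √d := by
    rw [← norm_one_sq, Real.sqrt_sq (norm_nonneg _)]
  rwa [mul_one, hRR, h3] at h

lemma norm_sub_sq_le_of_mem_precSet (hτ : 0 < τ) (hτζ : τ ≤ ζ) {X Y : Mat d}
    (hX : X ∈ precSet d τ ζ) (hY : Y ∈ precSet d τ ζ) : ‖X - Y‖ ^ 2 ≤ 4 * d * ζ ^ 2 := by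
  have h1 := norm_sub_le X Y
  have h2 := norm_le_of_mem_precSet hτ hτζ hX
  have h3 := norm_le_of_mem_precSet hτ hτζ hY
  have h4 : ‖X - Y‖ ≤ 2 * (ζ * √d) := by linarith
  have h5 := pow_le_pow_left₀ (norm_nonneg _) h4 2
  have h6 : √(d : ℝ) ^ 2 = d := Real.sq_sqrt d.cast_nonneg
  calc ‖X - Y‖ ^ 2 ≤ (2 * (ζ * √d)) ^ 2 := h5
    _ = 4 * √d ^ 2 * ζ ^ 2 := by ring
    _ = _ := by rw [h6]

lemma precSet_convex_comb (hτ : 0 < τ) (hτζ : τ ≤ ζ) {X Y : Mat d} (hX : X ∈ precSet d τ ζ)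
    (hY : Y ∈ precSet d τ ζ) {t : ℝ} (h0 : 0 ≤ t) (h1 : t ≤ 1) :
    X + t • (Y - X) ∈ precSet d τ ζ := by
  rw [mem_precSet_iff hτ hτζ] at hX hY ⊢
  have a := ((Matrix.le_iff.1 hX.1).smul (sub_nonneg.2 h1)).add ((Matrix.le_iff.1 hY.1).smul h0)
  have b := ((Matrix.le_iff.1 hX.2).smul (sub_nonneg.2 h1)).add ((Matrix.le_iff.1 hY.2).smul h0)
  constructor
  · refine Matrix.le_iff.2 ?_
    convert a using 1
    module
  · refine Matrix.le_iff.2 ?_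
    convert b using 1
    module

/-- The variational inequality of the projection. -/
lemma frob_sub_proj_le_zero (hτ : 0 < τ) (hτζ : τ ≤ ζ) (A : Mat d) {Y : Mat d}
    (hY : Y ∈ precSet d τ ζ) : frob (A - proj τ ζ A) (Y - proj τ ζ A) ≤ 0 := by
  obtain ⟨hP, hmin⟩ := proj_spec hτ hτζ A
  set P := proj τ ζ A
  by_contra! hc
  set c := frob (A - P) (Y - P) with hcdef
  set n := ‖Y - P‖ ^ 2 with hn
  have hn0 : 0 ≤ n := sq_nonneg _
  -- First-order optimality: compare `P` with the feasible points `P + t (Y - P)`; a small `t`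
  -- contradicts `0 < c`.
  have key : ∀ t : ℝ, 0 < t → t ≤ 1 → 2 * c ≤ t * n := by
    intro t h0 h1
    have h := pow_le_pow_left₀ (norm_nonneg _)
      (hmin _ (precSet_convex_comb hτ hτζ hP hY h0.le h1)) 2
    rw [← sub_sub, norm_sub_sq_frob (A - P), frob_smul_right, norm_smul, mul_pow,
      Real.norm_eq_abs, sq_abs, ← hn, ← hcdef] at h
    have h2 : t * (2 * c) ≤ t * (t * n) := by linarith
    exact le_of_mul_le_mul_left h2 h0
  have h1 := key 1 one_pos le_rfl
  have hnp : 0 < n := by linarith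
  have h2 := key (c / n) (by positivity) (by rw [div_le_one hnp]; linarith)
  rw [div_mul_cancel₀ _ hnp.ne'] at h2
  linarith

lemma norm_proj_sub_le (hτ : 0 < τ) (hτζ : τ ≤ ζ) (A : Mat d) {Y : Mat d}
    (hY : Y ∈ precSet d τ ζ) : ‖proj τ ζ A - Y‖ ^ 2 ≤ ‖A - Y‖ ^ 2 := by
  have h := frob_sub_proj_le_zero hτ hτζ A hY
  have e : A - Y = (A - proj τ ζ A) - (Y - proj τ ζ A) := by abel
  have e2 : ‖proj τ ζ A - Y‖ = ‖Y - proj τ ζ A‖ := norm_sub_rev _ _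
  rw [e2, e, norm_sub_sq_frob (A - proj τ ζ A)]
  nlinarith [sq_nonneg ‖A - proj τ ζ A‖]

lemma norm_proj_sub_proj_le (hτ : 0 < τ) (hτζ : τ ≤ ζ) (A B : Mat d) :
    ‖proj τ ζ A - proj τ ζ B‖ ≤ ‖A - B‖ := by
  have h1 := frob_sub_proj_le_zero hτ hτζ A (proj_spec hτ hτζ B).1
  have h2 := frob_sub_proj_le_zero hτ hτζ B (proj_spec hτ hτζ A).1
  set p := proj τ ζ A
  set q := proj τ ζ B
  have h3 : ‖p - q‖ ^ 2 ≤ frob (A - B) (p - q) := by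
    rw [← frob_self]
    simp only [frob_sub_left, frob_sub_right] at h1 h2 ⊢
    linarith
  have h4 := (le_abs_self _).trans (frob_le_norm_mul_norm (A - B) (p - q))
  by_contra! hc
  have hp : 0 < ‖p - q‖ := (norm_nonneg _).trans_lt hc
  nlinarith

lemma continuous_proj (hτ : 0 < τ) (hτζ : τ ≤ ζ) :
    Continuous (proj τ ζ : Mat d → Mat d) :=
  (LipschitzWith.of_dist_le_mul (K := 1) fun A B => by
    simpa [dist_eq_norm] using norm_proj_sub_proj_le hτ hτζ A B).continuous

/-- The drift towards the projected Hessian. -/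
lemma frob_drift_le (hτ : 0 < τ) (hτζ : τ ≤ ζ) (H : Mat d) {X : Mat d}
    (hX : X ∈ precSet d τ ζ) :
    frob (H - X) (X - proj τ ζ H) ≤ -‖X - proj τ ζ H‖ ^ 2 := by
  have h := frob_sub_proj_le_zero hτ hτζ H hX
  rw [← frob_self]
  simp only [frob_sub_left, frob_sub_right] at h ⊢
  linarith

/-- Each eigenvalue `c` of the square root is nonnegative with `τ ≤ c²`. This lower bound is what
makes the square root Lipschitz on `𝒮'`. -/
lemma matSqrt_sub_posSemidef (hτ : 0 < τ) (hτζ : τ ≤ ζ) {X : Mat d} (hX : X ∈ precSet d τ ζ) :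
    (matSqrt X - √τ • (1 : Mat d)).PosSemidef := by
  have hP := precSet_posDef hτ hτζ hX
  have hR : (matSqrt X).PosSemidef := Matrix.nonneg_iff_posSemidef.1 (CFC.sqrt_nonneg X)
  have hRR : matSqrt X * matSqrt X = X := CFC.sqrt_mul_sqrt_self _ hP.posSemidef.nonneg
  have hRs := isSymm_of_posSemidef hR
  obtain ⟨e, c, he, hq, -, -⟩ := exists_diagonalization hRs
  have hquad : ∀ (A : Mat d), A.PosSemidef → ∀ u, 0 ≤ quad A u := by
    intro A hA u
    have h := (Matrix.posSemidef_iff_dotProduct_mulVec.1 hA).2 u.ofLp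
    simpa [quad, inner_eq_sum, dotProduct, app] using h
  have hc : ∀ j, √τ ≤ c j := by
    intro j
    have hn : ‖e j‖ ^ 2 = 1 := by simp
    have h1 : quad X (e j) = c j ^ 2 := by
      have : app X (e j) = app (matSqrt X) (app (matSqrt X) (e j)) := by
        conv_lhs => rw [← hRR]
        simp [app, Matrix.mulVec_mulVec]
      rw [quad, this, inner_app_transpose, hRs.eq, he, real_inner_smul_left,
        real_inner_smul_right, real_inner_self_eq_norm_sq, hn]
      ring
    have h2 := hquad _ (Matrix.le_iff.1 ((mem_precSet_iff hτ hτζ X).1 hX).1) (e j)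
    rw [quad_sub, quad_smul, quad_one, hn, h1] at h2
    have h3 : 0 ≤ c j := by
      have := hquad _ hR (e j)
      rwa [quad, he, real_inner_smul_right, real_inner_self_eq_norm_sq, hn, mul_one] at this
    exact Real.sqrt_le_iff.2 ⟨h3, by linarith⟩
  refine Matrix.posSemidef_iff_dotProduct_mulVec.2 ⟨?_, fun x => ?_⟩
  · have h : (matSqrt X - √τ • (1 : Mat d)).IsSymm :=
      hRs.sub ((Matrix.isSymm_one (n := Fin d) (α := ℝ)).smul _)
    rw [Matrix.IsHermitian, Matrix.conjTranspose_eq_transpose_of_trivial]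
    exact h
  · have h : 0 ≤ quad (matSqrt X - √τ • (1 : Mat d)) (WithLp.toLp 2 x) := by
      rw [quad_sub, quad_smul, quad_one, hq, ← e.sum_sq_norm_inner_right, Finset.mul_sum,
        ← Finset.sum_sub_distrib]
      refine Finset.sum_nonneg fun j _ => ?_
      rw [Real.norm_eq_abs, sq_abs, ← sub_mul]
      exact mul_nonneg (sub_nonneg.2 (hc j)) (sq_nonneg _)
    simpa [quad, inner_eq_sum, dotProduct, app] using h

lemma continuousOn_matSqrt (hτ : 0 < τ) (hτζ : τ ≤ ζ) :
    ContinuousOn (matSqrt : Mat d → Mat d) (precSet d τ ζ) := by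
  have hs : 0 < √τ := Real.sqrt_pos.2 hτ
  have hlip : LipschitzOnWith (Real.toNNReal (2 * √τ)⁻¹) (matSqrt : Mat d → Mat d)
      (precSet d τ ζ) := by
    refine LipschitzOnWith.of_dist_le_mul fun A hA B hB => ?_
    rw [dist_eq_norm, dist_eq_norm, Real.coe_toNNReal _ (by positivity)]
    have hAA : matSqrt A * matSqrt A = A :=
      CFC.sqrt_mul_sqrt_self _ (precSet_posDef hτ hτζ hA).posSemidef.nonneg
    have hBB : matSqrt B * matSqrt B = B :=
      CFC.sqrt_mul_sqrt_self _ (precSet_posDef hτ hτζ hB).posSemidef.nonneg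
    set R := matSqrt A with hR
    set S := matSqrt B with hS
    have h1 := frob_self_mul_nonneg (matSqrt_sub_posSemidef hτ hτζ hA) (R - S)
    have h2 := frob_self_mul_right_nonneg (matSqrt_sub_posSemidef hτ hτζ hB) (R - S)
    rw [← hR, sub_mul, Matrix.smul_mul, one_mul, frob_sub_right, frob_smul_right, frob_self] at h1
    rw [← hS, mul_sub, Matrix.mul_smul, mul_one, frob_sub_right, frob_smul_right, frob_self] at h2
    -- Pairing this splitting with `R - S` gives at least `2√τ ‖R - S‖²`, since both factors `R`,
    -- `S` dominate `√τ I`.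
    have e : A - B = R * (R - S) + (R - S) * S := by
      rw [← hAA, ← hBB]; noncomm_ring
    have h3 : 2 * √τ * ‖R - S‖ ^ 2 ≤ frob (R - S) (A - B) := by
      rw [e, frob_add_right]; linarith
    have h4 := (le_abs_self _).trans (frob_le_norm_mul_norm (R - S) (A - B))
    rw [inv_mul_eq_div, le_div_iff₀ (by positivity)]
    rcases (norm_nonneg (R - S)).eq_or_lt with h | h
    · rw [← h, zero_mul]; positivity
    · refine le_of_mul_le_mul_left ?_ h
      linarith
  exact hlip.continuousOn

end Geometry

/-! ### Mean, size and variance of the Hessian estimate. -/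

section Estimator

variable {d : ℕ}

/-- Adding the expansions from `0` to `v` and back writes `vᵀ H v` as `⟨∇f(v) - ∇f(0), v⟩`. -/
lemma abs_quad_le {f : Vec d → ℝ} {H : Mat d} {L : ℝ} (hf : IsQuadratic f H) (hL : IsSmooth f L)
    (v : Vec d) : |quad H v| ≤ L * ‖v‖ ^ 2 := by
  have h1 := hf.2 0 v
  have h2 := hf.2 v 0
  have e : inner ℝ (0 - v) (app H (0 - v)) = quad H v := by
    rw [zero_sub, quad, app, app, WithLp.ofLp_neg, Matrix.mulVec_neg, WithLp.toLp_neg,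
      inner_neg_neg]
  rw [sub_zero] at h1
  rw [e, zero_sub, inner_neg_right] at h2
  have h3 : quad H v = inner ℝ (gradient f v - gradient f 0) v := by
    rw [inner_sub_left, quad]
    rw [quad] at h2
    linarith
  rw [h3]
  refine (abs_real_inner_le_norm _ _).trans ?_
  have h4 := hL.2 v 0
  rw [sub_zero] at h4
  nlinarith [mul_le_mul_of_nonneg_right h4 (norm_nonneg v)]

/-- The estimate `G̃` for a quadratic function, in terms of the precision matrix `X = Σ⁻¹`. -/
noncomputable def precGrad (H X : Mat d) (u : Vec d) : Mat d :=
  (1 / 2 * quad H (app (matSqrt X⁻¹) u)) •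
    ((matSqrt X⁻¹)⁻¹ * outer u * (matSqrt X⁻¹)⁻¹ - X) - X

/-- The gradient terms cancel in the symmetric second difference and `α²` divides out. Hence the
mean iterates, and with them the step sizes `η₁`, have no influence on the precision matrices. -/
lemma GEst_eq_precGrad {f : Vec d → ℝ} {H : Mat d} (hf : IsQuadratic f H) {α : ℝ} (hα : 0 < α)
    (μ : Vec d) (S : Mat d) (hS : S⁻¹⁻¹ = S) (u : Fin 1 → Vec d) :
    GEst f α μ S u = precGrad H S⁻¹ (u 0) := by
  have h1 := hf.2 μ (μ + α • app (matSqrt S) (u 0))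
  have h2 := hf.2 μ (μ - α • app (matSqrt S) (u 0))
  have e : ∀ c : ℝ, inner ℝ (c • app (matSqrt S) (u 0)) (app H (c • app (matSqrt S) (u 0)))
      = c ^ 2 * quad H (app (matSqrt S) (u 0)) := by
    intro c
    have : app H (c • app (matSqrt S) (u 0)) = c • app H (app (matSqrt S) (u 0)) := by
      simp [app, Matrix.mulVec_smul]
    rw [this, quad, real_inner_smul_left, real_inner_smul_right]
    ring
  rw [add_sub_cancel_left, e] at h1
  rw [sub_sub_cancel_left, ← neg_smul, e, neg_smul, inner_neg_right] at h2
  rw [GEst, precGrad, hS, Fin.sum_univ_one, smul_smul]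
  congr 2
  rw [h1, h2]
  push_cast
  field_simp
  ring

variable {τ ζ : ℝ}

lemma quad_app (A B : Mat d) (hB : B.IsSymm) (u : Vec d) :
    quad A (app B u) = quad (B * A * B) u := by
  have e : app (B * A * B) u = app B (app A (app B u)) := by
    simp [app, Matrix.mulVec_mulVec, mul_assoc]
  rw [quad, quad, e, inner_app_transpose B, hB.eq]

lemma conj_isSymm {A R : Mat d} (hA : A.IsSymm) (hR : R.IsSymm) : (R * A * R).IsSymm := by
  rw [Matrix.IsSymm, Matrix.transpose_mul, Matrix.transpose_mul, hA.eq, hR.eq, mul_assoc]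

lemma abs_quad_conj_le (hτ : 0 < τ) (hτζ : τ ≤ ζ) {H X : Mat d} {L : ℝ} (hL0 : 0 ≤ L)
    (hHL : ∀ v, |quad H v| ≤ L * ‖v‖ ^ 2) (hX : X ∈ precSet d τ ζ) (u : Vec d) :
    |quad (matSqrt X⁻¹ * H * matSqrt X⁻¹) u| ≤ L / τ * ‖u‖ ^ 2 := by
  obtain ⟨hQ, -, hQQ, -, -, -, -⟩ := sqrt_inv_facts hτ hτζ hX
  rw [← quad_app _ _ hQ]
  refine (hHL _).trans ?_
  have hS : X⁻¹ ∈ covSet d τ ζ := by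
    obtain ⟨S, hS, hXS⟩ := hX
    have hX' : X ∈ precSet d τ ζ := ⟨S, hS, hXS⟩
    have hζ := hτ.trans_le hτζ
    -- `𝒮` is itself a set of type `𝒮'`, with bounds `ζ⁻¹` and `τ⁻¹`.
    have h := (mem_precSet_iff (inv_pos.2 hζ) (inv_anti₀ hτ hτζ) S).2 hS
    rwa [hXS, inv_inv_precSet (inv_pos.2 hζ) (inv_anti₀ hτ hτζ) h]
  have h1 : ‖app (matSqrt X⁻¹) u‖ ^ 2 = quad X⁻¹ u := by
    rw [← quad_one, quad_app _ _ hQ, mul_one, hQQ]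
  have h2 : (Matrix.PosSemidef (τ⁻¹ • (1 : Mat d) - X⁻¹)) := Matrix.le_iff.1 hS.2
  have h3 : 0 ≤ quad (τ⁻¹ • (1 : Mat d) - X⁻¹) u := by
    have h := (Matrix.posSemidef_iff_dotProduct_mulVec.1 h2).2 u.ofLp
    simpa [quad, inner_eq_sum, dotProduct, app] using h
  rw [quad_sub, quad_smul, quad_one] at h3
  rw [h1]
  calc L * quad X⁻¹ u ≤ L * (τ⁻¹ * ‖u‖ ^ 2) := mul_le_mul_of_nonneg_left (by linarith) hL0
    _ = _ := by ring

lemma frob_conj_outer_sub (hτ : 0 < τ) (hτζ : τ ≤ ζ) {X : Mat d} (hX : X ∈ precSet d τ ζ)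
    (D : Mat d) (u : Vec d) :
    frob ((matSqrt X⁻¹)⁻¹ * outer u * (matSqrt X⁻¹)⁻¹ - X) D
      = chaos ((matSqrt X⁻¹)⁻¹ * D * (matSqrt X⁻¹)⁻¹) u := by
  obtain ⟨-, hR, -, hRR, -, -, -⟩ := sqrt_inv_facts hτ hτζ hX
  set R := (matSqrt X⁻¹)⁻¹
  have hconj : ∀ Y : Mat d, frob (R * Y * R) D = frob Y (R * D * R) := by
    intro Y
    simp only [frob_eq_trace, Matrix.transpose_mul, hR.eq]
    rw [mul_assoc, mul_assoc, Matrix.trace_mul_comm]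
    simp only [mul_assoc]
  rw [frob_sub_left, hconj, chaos, quad_eq_frob_outer, frob_comm, ← frob_one_right, frob_comm _ 1,
    ← hconj, mul_one, hRR]

/-- The noise of the estimate in the direction `D`, as a product of quadratic forms. -/
lemma frob_precGrad_sub (hτ : 0 < τ) (hτζ : τ ≤ ζ) {H X : Mat d}
    (hX : X ∈ precSet d τ ζ) (D : Mat d) (u : Vec d) :
    frob (precGrad H X u - (H - X)) D
      = 1 / 2 * (quad (matSqrt X⁻¹ * H * matSqrt X⁻¹) u
          * chaos ((matSqrt X⁻¹)⁻¹ * D * (matSqrt X⁻¹)⁻¹) u) - frob H D := by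
  obtain ⟨hQ, -, -, -, -, -, -⟩ := sqrt_inv_facts hτ hτζ hX
  rw [precGrad, quad_app _ _ hQ, sub_sub_sub_cancel_right, frob_sub_left, frob_smul_left,
    frob_conj_outer_sub hτ hτζ hX]
  ring

lemma norm_precGrad_le (hτ : 0 < τ) (hτζ : τ ≤ ζ) {H X : Mat d} {L M : ℝ} (hL0 : 0 ≤ L)
    (hHL : ∀ v, |quad H v| ≤ L * ‖v‖ ^ 2) (hX : X ∈ precSet d τ ζ) {u : Vec d}
    (hu : ‖u‖ ^ 2 ≤ M) :
    ‖precGrad H X u‖ ≤ 1 / 2 * (L / τ) * ζ * (M * (M + √d)) + ζ * √d := by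
  obtain ⟨hQ, hR, -, hRR, -, -, -⟩ := sqrt_inv_facts hτ hτζ hX
  have hζ := hτ.trans_le hτζ
  have hM : 0 ≤ M := (sq_nonneg _).trans hu
  have h1 := norm_le_of_mem_precSet hτ hτζ hX
  have h2 := norm_conj_le hR hRR hζ.le ((mem_precSet_iff hτ hτζ X).1 hX).2 (outer u)
  have h3 := abs_quad_conj_le hτ hτζ hL0 hHL hX u
  rw [← quad_app _ _ hQ] at h3
  rw [norm_outer] at h2
  rw [precGrad]
  refine (norm_sub_le _ _).trans (add_le_add ?_ h1)
  rw [norm_smul, Real.norm_eq_abs, abs_mul, abs_of_pos (by norm_num : (0 : ℝ) < 1 / 2)]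
  have h4 := norm_sub_le ((matSqrt X⁻¹)⁻¹ * outer u * (matSqrt X⁻¹)⁻¹) X
  have h5 : ‖(matSqrt X⁻¹)⁻¹ * outer u * (matSqrt X⁻¹)⁻¹ - X‖ ≤ ζ * (M + √d) := by
    have := mul_le_mul_of_nonneg_left hu hζ.le
    linarith
  have h6 : |quad H (app (matSqrt X⁻¹) u)| ≤ L / τ * M :=
    h3.trans (mul_le_mul_of_nonneg_left hu (by positivity))
  calc 1 / 2 * |quad H (app (matSqrt X⁻¹) u)|
        * ‖(matSqrt X⁻¹)⁻¹ * outer u * (matSqrt X⁻¹)⁻¹ - X‖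
      ≤ 1 / 2 * (L / τ * M) * (ζ * (M + √d)) := by gcongr
    _ = _ := by ring

/-- Second moment bound for the noise. -/
lemma exists_dominating_noise (hτ : 0 < τ) (hτζ : τ ≤ ζ) {H X D : Mat d} {L : ℝ} (hL0 : 0 ≤ L)
    (hH : H.IsSymm) (hHL : ∀ v, |quad H v| ≤ L * ‖v‖ ^ 2) (hX : X ∈ precSet d τ ζ)
    (hD : D.IsSymm) :
    Integrable (fun u => frob (precGrad H X u - (H - X)) D) (stdGaussian (Vec d)) ∧
    ∫ u, frob (precGrad H X u - (H - X)) D ∂(stdGaussian (Vec d)) = 0 ∧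
    ∃ W : Vec d → ℝ, Integrable W (stdGaussian (Vec d)) ∧
      (∀ u, frob (precGrad H X u - (H - X)) D ^ 2 ≤ W u) ∧
      ∫ u, W u ∂(stdGaussian (Vec d))
        ≤ (d ^ 2 + 30 * d) * (L / τ * ζ) ^ 2 * ‖D‖ ^ 2 - frob H D ^ 2 := by
  obtain ⟨hQ, hR, -, hRR, hQR, hRQ, -⟩ := sqrt_inv_facts hτ hτζ hX
  have hζ := hτ.trans_le hτζ
  have hnorm := norm_conj_le hR hRR hζ.le ((mem_precSet_iff hτ hτζ X).1 hX).2 D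
  have hq := abs_quad_conj_le hτ hτζ hL0 hHL hX
  simp only [frob_precGrad_sub hτ hτζ hX]
  set Q := matSqrt X⁻¹
  set R := Q⁻¹
  have hA : (Q * H * Q).IsSymm := conj_isSymm hH hQ
  have hB : (R * D * R).IsSymm := conj_isSymm hD hR
  obtain ⟨I, v⟩ := quad_mul_chaos hA hB
  -- The two conjugations are inverse to each other, so the mean of the estimate no longer depends
  -- on `X`.
  have hfrob : frob (Q * H * Q) (R * D * R) = frob H D := by
    simp only [frob_eq_trace, Matrix.transpose_mul, hR.eq]
    have e : Q * H * Q * (R * (D.transpose * R)) = Q * (H * D.transpose) * R := by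
      calc Q * H * Q * (R * (D.transpose * R)) = Q * H * (Q * R) * (D.transpose * R) := by
            noncomm_ring
        _ = _ := by rw [hQR, mul_one]; noncomm_ring
    rw [e, Matrix.trace_mul_comm, ← mul_assoc, hRQ, one_mul]
  rw [hfrob] at v
  obtain ⟨W, hWi, hWd, hWv⟩ := exists_dominating_norm_four_mul_chaos_sq hB
  set m := frob H D
  have J := (I.const_mul (1 / 2)).sub (integrable_const m)
  refine ⟨J, ?_, fun u => (1 / 4 * (L / τ) ^ 2 * W u
    + (-m) * (quad (Q * H * Q) u * chaos (R * D * R) u)) + m ^ 2, ?_, fun u => ?_, ?_⟩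
  · rw [integral_sub (I.const_mul _) (integrable_const m), integral_const_mul, v]
    simp
  · exact ((hWi.const_mul _).fun_add (I.const_mul _)).fun_add (integrable_const _)
  · set q := quad (Q * H * Q) u with hqdef
    set p := chaos (R * D * R) u
    have h1 : q ^ 2 ≤ (L / τ) ^ 2 * ‖u‖ ^ 4 := by
      have := pow_le_pow_left₀ (abs_nonneg _) (hq u) 2
      rw [sq_abs] at this
      calc q ^ 2 ≤ (L / τ * ‖u‖ ^ 2) ^ 2 := this
        _ = _ := by ring
    have h2 : q ^ 2 * p ^ 2 ≤ (L / τ) ^ 2 * W u := by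
      calc q ^ 2 * p ^ 2 ≤ (L / τ) ^ 2 * ‖u‖ ^ 4 * p ^ 2 :=
            mul_le_mul_of_nonneg_right h1 (sq_nonneg _)
        _ = (L / τ) ^ 2 * (‖u‖ ^ 4 * p ^ 2) := by ring
        _ ≤ _ := mul_le_mul_of_nonneg_left (hWd u) (sq_nonneg _)
    linarith
  · rw [integral_add ((hWi.const_mul _).fun_add (I.const_mul _)) (integrable_const _),
      integral_add (hWi.const_mul _) (I.const_mul _), integral_const_mul, integral_const_mul, v]
    have h1 : ‖R * D * R‖ ^ 2 ≤ ζ ^ 2 * ‖D‖ ^ 2 := by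
      rw [← mul_pow]; exact pow_le_pow_left₀ (norm_nonneg _) hnorm 2
    have h2 : ∫ u, W u ∂(stdGaussian (Vec d)) ≤ (4 * d ^ 2 + 120 * d) * (ζ ^ 2 * ‖D‖ ^ 2) :=
      hWv.trans (mul_le_mul_of_nonneg_left h1 (by positivity))
    have h3 := mul_le_mul_of_nonneg_left h2 (by positivity : 0 ≤ 1 / 4 * (L / τ) ^ 2)
    simp only [integral_const, probReal_univ, one_smul]
    linarith

/-- Exponential moment of the noise truncated from above. -/
lemma lintegral_exp_min_noise_le (hτ : 0 < τ) (hτζ : τ ≤ ζ) {H X D : Mat d} {L : ℝ} (hL0 : 0 ≤ L)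
    (hH : H.IsSymm) (hHL : ∀ v, |quad H v| ≤ L * ‖v‖ ^ 2) (hX : X ∈ precSet d τ ζ)
    (hD : D.IsSymm) (c : ℝ) :
    ∫⁻ u, ENNReal.ofReal (Real.exp (min (c * frob (precGrad H X u - (H - X)) D) 1))
        ∂(stdGaussian (Vec d))
      ≤ ENNReal.ofReal (Real.exp (c ^ 2 * ((d ^ 2 + 30 * d) * (L / τ * ζ) ^ 2 * ‖D‖ ^ 2))) := by
  obtain ⟨I, v, W, hW, hWd, hWv⟩ := exists_dominating_noise hτ hτζ hL0 hH hHL hX hD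
  set Z : Vec d → ℝ := fun u => frob (precGrad H X u - (H - X)) D
  -- Only positive values are truncated, so the linear term is still the untruncated noise and
  -- integrates to zero.
  have hexp : ∀ z : ℝ, Real.exp (min z 1) ≤ 1 + z + z ^ 2 := by
    intro z
    rcases le_total z 1 with h | h
    · rw [min_eq_left h]
      rcases le_total (-1) z with h' | h'
      · have := Real.abs_exp_sub_one_sub_id_le (abs_le.2 ⟨h', h⟩)
        linarith [le_abs_self (Real.exp z - 1 - z)]
      · have := Real.exp_le_exp.2 h'
        have h1 : Real.exp (-1) ≤ 1 := Real.exp_le_one_iff.2 (by norm_num)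
        nlinarith
    · rw [min_eq_right h]
      have := Real.exp_one_lt_d9
      nlinarith
  have hdom : ∀ u, Real.exp (min (c * Z u) 1) ≤ 1 + c * Z u + c ^ 2 * W u := by
    intro u
    have h1 := hexp (c * Z u)
    have h2 := mul_le_mul_of_nonneg_left (hWd u) (sq_nonneg c)
    rw [mul_pow] at h1
    linarith
  have hi : Integrable (fun u => 1 + c * Z u + c ^ 2 * W u) (stdGaussian (Vec d)) :=
    ((integrable_const _).fun_add (I.const_mul c)).fun_add (hW.const_mul _)
  calc ∫⁻ u, ENNReal.ofReal (Real.exp (min (c * Z u) 1)) ∂(stdGaussian (Vec d))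
      ≤ ∫⁻ u, ENNReal.ofReal (1 + c * Z u + c ^ 2 * W u) ∂(stdGaussian (Vec d)) :=
        lintegral_mono fun u => ENNReal.ofReal_le_ofReal (hdom u)
    _ = ENNReal.ofReal (∫ u, 1 + c * Z u + c ^ 2 * W u ∂(stdGaussian (Vec d))) :=
        (ofReal_integral_eq_lintegral_ofReal hi
          (ae_of_all _ fun u => (Real.exp_pos _).le.trans (hdom u))).symm
    _ ≤ _ := by
        refine ENNReal.ofReal_le_ofReal ?_
        rw [integral_add ((integrable_const _).fun_add (I.const_mul c)) (hW.const_mul _),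
          integral_add (integrable_const _) (I.const_mul c), integral_const_mul,
          integral_const_mul, v]
        simp only [integral_const, probReal_univ, one_smul]
        have h1 := mul_le_mul_of_nonneg_left (hWv.trans (sub_le_self _ (sq_nonneg _)))
          (sq_nonneg c)
        have h2 := Real.add_one_le_exp
          (c ^ 2 * ((d ^ 2 + 30 * d) * (L / τ * ζ) ^ 2 * ‖D‖ ^ 2))
        linarith

/-- Bound for the noise on the event where the sample is not too large. -/
lemma abs_noise_le (hτ : 0 < τ) (hτζ : τ ≤ ζ) {H X D : Mat d} {L M : ℝ} (hL0 : 0 ≤ L)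
    (hH : H.IsSymm) (hHL : ∀ v, |quad H v| ≤ L * ‖v‖ ^ 2) (hX : X ∈ precSet d τ ζ)
    (hD : D.IsSymm) {u : Vec d} (hu : ‖u‖ ^ 2 ≤ M) :
    |frob (precGrad H X u - (H - X)) D|
      ≤ (1 / 2 * M * (M + √d) + √(d ^ 2 + 30 * d)) * (L / τ * ζ) * ‖D‖ := by
  obtain ⟨-, -, W, hW, hWd, hWv⟩ := exists_dominating_noise hτ hτζ hL0 hH hHL hX hD
  have hζ := hτ.trans_le hτζ
  have hM : 0 ≤ M := (sq_nonneg _).trans hu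
  -- The variance bound minus `⟨H, D⟩²` dominates a nonnegative integral, which bounds `⟨H, D⟩`
  -- without a separate estimate of `‖H‖`.
  have hm : |frob H D| ≤ √(d ^ 2 + 30 * d) * (L / τ * ζ) * ‖D‖ := by
    have h0 : 0 ≤ ∫ u, W u ∂(stdGaussian (Vec d)) :=
      integral_nonneg fun u => (sq_nonneg _).trans (hWd u)
    refine abs_le_of_sq_le_sq ?_ (by positivity)
    rw [mul_pow, mul_pow, Real.sq_sqrt (by positivity)]
    linarith
  obtain ⟨-, hR, -, hRR, -, -, -⟩ := sqrt_inv_facts hτ hτζ hX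
  have hnorm := norm_conj_le hR hRR hζ.le ((mem_precSet_iff hτ hτζ X).1 hX).2 D
  have hq := abs_quad_conj_le hτ hτζ hL0 hHL hX u
  have hp := abs_chaos_le ((matSqrt X⁻¹)⁻¹ * D * (matSqrt X⁻¹)⁻¹) u
  rw [frob_precGrad_sub hτ hτζ hX]
  refine (abs_sub _ _).trans ?_
  rw [abs_mul, abs_mul, abs_of_pos (by norm_num : (0 : ℝ) < 1 / 2)]
  have h1 : |quad (matSqrt X⁻¹ * H * matSqrt X⁻¹) u| ≤ L / τ * M :=
    hq.trans (mul_le_mul_of_nonneg_left hu (by positivity))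
  have h2 : |chaos ((matSqrt X⁻¹)⁻¹ * D * (matSqrt X⁻¹)⁻¹) u| ≤ (M + √d) * (ζ * ‖D‖) :=
    hp.trans (by gcongr)
  have h3 : 1 / 2 * (|quad (matSqrt X⁻¹ * H * matSqrt X⁻¹) u|
      * |chaos ((matSqrt X⁻¹)⁻¹ * D * (matSqrt X⁻¹)⁻¹) u|)
      ≤ 1 / 2 * ((L / τ * M) * ((M + √d) * (ζ * ‖D‖))) := by gcongr
  linarith

end Estimator

/-! ### The error recursion and its deterministic solution. -/

section Recursion

variable {d : ℕ}

/-- The precision matrices `X_{n+1} = Σ_{n+1}⁻¹` as a function of the samples. -/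
noncomputable def precIter (τ ζ : ℝ) (H X₁ : Mat d) (v : ℕ → Vec d) : ℕ → Mat d
  | 0 => X₁
  | n + 1 => proj τ ζ (precIter τ ζ H X₁ v n
      + (1 / ((n + 1 : ℕ) : ℝ)) • precGrad H (precIter τ ζ H X₁ v n) (v (n + 1)))

variable {τ ζ : ℝ}

lemma precIter_mem (hτ : 0 < τ) (hτζ : τ ≤ ζ) (H : Mat d) {X₁ : Mat d}
    (hX₁ : X₁ ∈ precSet d τ ζ) (v : ℕ → Vec d) (n : ℕ) :
    precIter τ ζ H X₁ v n ∈ precSet d τ ζ := by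
  cases n with
  | zero => exact hX₁
  | succ n => exact (proj_spec hτ hτζ _).1

lemma precIter_congr (H X₁ : Mat d) {v w : ℕ → Vec d} {n : ℕ} (h : ∀ j ≤ n, v j = w j) :
    precIter τ ζ H X₁ v n = precIter τ ζ H X₁ w n := by
  induction n with
  | zero => rfl
  | succ n ih =>
    rw [precIter, precIter, ih fun j hj => h j (hj.trans n.le_succ), h (n + 1) le_rfl]

/-- The second identity is carried along because the estimate takes the root of `Σ`, while the
recursion takes it of `(Σ⁻¹)⁻¹`. -/
lemma inv_iter_eq_precIter (hτ : 0 < τ) (hτζ : τ ≤ ζ) {f : Vec d → ℝ} {H : Mat d}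
    (hf : IsQuadratic f H) {α : ℝ} (hα : 0 < α) (η₁ : ℕ → ℝ) (μ₁ : Vec d) {S₁ : Mat d}
    (hS₁ : S₁ ∈ covSet d τ ζ) (u : ℕ → Fin 1 → Vec d) (n : ℕ) :
    (iter f α τ ζ η₁ (fun j => 1 / (j : ℝ)) (μ₁, S₁) u (n + 1)).2⁻¹
        = precIter τ ζ H S₁⁻¹ (fun j => u j 0) n ∧
    (iter f α τ ζ η₁ (fun j => 1 / (j : ℝ)) (μ₁, S₁) u (n + 1)).2⁻¹⁻¹
        = (iter f α τ ζ η₁ (fun j => 1 / (j : ℝ)) (μ₁, S₁) u (n + 1)).2 := by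
  have hζ := hτ.trans_le hτζ
  have hX₁ : S₁⁻¹ ∈ precSet d τ ζ := ⟨S₁, hS₁, rfl⟩
  induction n with
  | zero =>
    refine ⟨rfl, ?_⟩
    have h := (mem_precSet_iff (inv_pos.2 hζ) (inv_anti₀ hτ hτζ) S₁).2 hS₁
    exact inv_inv_precSet (inv_pos.2 hζ) (inv_anti₀ hτ hτζ) h
  | succ n ih =>
    obtain ⟨h1, h2⟩ := ih
    have h3 : (iter f α τ ζ η₁ (fun j => 1 / (j : ℝ)) (μ₁, S₁) u (n + 2)).2⁻¹
        = precIter τ ζ H S₁⁻¹ (fun j => u j 0) (n + 1) := by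
      rw [iter, step]
      simp only []
      rw [inv_inv_precSet hτ hτζ (proj_spec hτ hτζ _).1, GEst_eq_precGrad hf hα _ _ h2, h1,
        precIter]
    refine ⟨h3, ?_⟩
    rw [h3, iter, step]
    simp only []
    rw [GEst_eq_precGrad hf hα _ _ h2, h1, precIter]

/-- The noise of iteration `n + 1` in the direction of the error. -/
noncomputable def iterNoise (τ ζ : ℝ) (H X₁ : Mat d) (v : ℕ → Vec d) (n : ℕ) : ℝ :=
  frob (precGrad H (precIter τ ζ H X₁ v n) (v (n + 1)) - (H - precIter τ ζ H X₁ v n))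
    (precIter τ ζ H X₁ v n - proj τ ζ H)

/-- The squared error recursion. -/
lemma sq_error_recursion (hτ : 0 < τ) (hτζ : τ ≤ ζ) (H : Mat d) {X₁ : Mat d}
    (hX₁ : X₁ ∈ precSet d τ ζ) (v : ℕ → Vec d) (n : ℕ) {B : ℝ}
    (hB : ‖precGrad H (precIter τ ζ H X₁ v n) (v (n + 1))‖ ^ 2 ≤ B) :
    ((n : ℝ) + 1) * n * ‖precIter τ ζ H X₁ v (n + 1) - proj τ ζ H‖ ^ 2
      ≤ n * (n - 1) * ‖precIter τ ζ H X₁ v n - proj τ ζ H‖ ^ 2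
        + 2 * n * iterNoise τ ζ H X₁ v n + n / (n + 1) * B := by
  have hn : (0 : ℝ) ≤ n := n.cast_nonneg
  have hn1 : (0 : ℝ) < (n : ℝ) + 1 := by positivity
  have hX := precIter_mem hτ hτζ H hX₁ v n
  have h1 := norm_proj_sub_le hτ hτζ (precIter τ ζ H X₁ v n
      + (1 / ((n + 1 : ℕ) : ℝ)) • precGrad H (precIter τ ζ H X₁ v n) (v (n + 1)))
      (proj_spec hτ hτζ H).1
  have h2 := frob_drift_le hτ hτζ H hX
  rw [precIter]
  unfold iterNoise
  set X := precIter τ ζ H X₁ v n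
  set G := precGrad H X (v (n + 1))
  set Y := proj τ ζ H
  rw [add_sub_right_comm, norm_add_sq_frob (X - Y), frob_smul_right, norm_smul, mul_pow,
    Real.norm_eq_abs, sq_abs, frob_comm (X - Y) G] at h1
  rw [frob_sub_left G]
  push_cast at h1 ⊢
  have h3 : (1 / ((n : ℝ) + 1)) ^ 2 * ‖G‖ ^ 2 ≤ (1 / ((n : ℝ) + 1)) ^ 2 * B :=
    mul_le_mul_of_nonneg_left hB (sq_nonneg _)
  have h4 := mul_le_mul_of_nonneg_left (h1.trans (add_le_add_right h3 _))
    (by positivity : 0 ≤ ((n : ℝ) + 1) * n)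
  have h5 := mul_le_mul_of_nonneg_left h2 hn
  have e : ((n : ℝ) + 1) * n * (‖X - Y‖ ^ 2 + 2 * (1 / ((n : ℝ) + 1) * frob G (X - Y))
      + (1 / ((n : ℝ) + 1)) ^ 2 * B)
      = ((n : ℝ) + 1) * n * ‖X - Y‖ ^ 2 + 2 * n * frob G (X - Y) + n / (n + 1) * B := by
    field_simp
  rw [e] at h4
  linarith

/-- From the recursion and a deviation bound for the accumulated noise to the rate. -/
lemma rate_of_recursion {a Z : ℕ → ℝ} {T : ℕ} {R B s ℓ : ℝ} (hs : 0 < s) (hR : 0 ≤ R)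
    (hB0 : 0 ≤ B) (ha : ∀ n, 0 ≤ a n)
    (hrec : ∀ n, n + 1 < T → ((n : ℝ) + 1) * n * a (n + 1)
      ≤ n * (n - 1) * a n + 2 * n * Z n + n / (n + 1) * B)
    (hdev : ∀ n, n + 1 < T → ∑ i ∈ Finset.range (n + 1), 1 / (4 * s * (n + 1)) * i * Z i
      ≤ ℓ + ∑ i ∈ Finset.range (n + 1), (1 / (4 * s * (n + 1)) * i) ^ 2 * (s * a i))
    (hsmall : ∀ n : ℕ, n < 20 → ((n : ℝ) + 1) * a n ≤ R)
    (hℓ : 8 * s * ℓ ≤ 4 / 15 * R) (hB : B ≤ 9 / 25 * R) :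
    ∀ n, n < T → ((n : ℝ) + 1) * a n ≤ R := by
  -- The weight `n` vanishes at the start, so the initial error leaves no trace in the telescoped
  -- sum.
  have hsum : ∀ n, n + 1 < T → ((n : ℝ) + 1) * n * a (n + 1)
      ≤ 2 * ∑ i ∈ Finset.range (n + 1), i * Z i + n * B := by
    intro n
    induction n with
    | zero => intro _; simp
    | succ n ih =>
      intro hn
      have h1 := ih (by omega)
      have h2 := hrec (n + 1) hn
      rw [Finset.sum_range_succ]
      push_cast at h2 ⊢
      have h3 : ((n : ℝ) + 1) / (n + 1 + 1) * B ≤ 1 * B := by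
        refine mul_le_mul_of_nonneg_right ?_ hB0
        rw [div_le_one (by positivity)]
        linarith
      linarith
  intro n
  induction n using Nat.strong_induction_on with
  | _ m ih =>
    intro hm
    rcases lt_or_ge m 20 with h | h
    · exact hsmall m h
    obtain ⟨n, rfl⟩ : ∃ n, m = n + 1 := ⟨m - 1, by omega⟩
    have hn : (19 : ℝ) ≤ n := by exact_mod_cast (by omega : 19 ≤ n)
    have h1 := hsum n hm
    have h2 := hdev n hm
    have h3 : ∑ i ∈ Finset.range (n + 1), (1 / (4 * s * (n + 1)) * i) ^ 2 * (s * a i)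
        ≤ (1 / (4 * s * (n + 1))) ^ 2 * s * (R * ((n : ℝ) * (n + 1) / 2)) := by
      have h4 : ∀ i ∈ Finset.range (n + 1), (1 / (4 * s * ((n : ℝ) + 1)) * i) ^ 2 * (s * a i)
          ≤ (1 / (4 * s * (n + 1))) ^ 2 * s * (R * i) := by
        intro i hi
        have hi' := Finset.mem_range.1 hi
        have h5 := ih i hi' (by omega)
        have hi0 : (0 : ℝ) ≤ i := i.cast_nonneg
        -- Here the rate at earlier times is fed back into the variance term, which then grows like
        -- `∑ i` instead of `∑ i²`.
        have h6 : (i : ℝ) ^ 2 * a i ≤ R * i := by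
          have := mul_le_mul_of_nonneg_left h5 hi0
          nlinarith [mul_nonneg hi0 (ha i)]
        calc (1 / (4 * s * ((n : ℝ) + 1)) * i) ^ 2 * (s * a i)
            = (1 / (4 * s * ((n : ℝ) + 1))) ^ 2 * s * (i ^ 2 * a i) := by ring
          _ ≤ _ := mul_le_mul_of_nonneg_left h6 (by positivity)
      refine (Finset.sum_le_sum h4).trans_eq ?_
      rw [← Finset.mul_sum, ← Finset.mul_sum]
      congr 2
      have h7 : ((∑ i ∈ Finset.range (n + 1), i : ℕ) : ℝ) * 2 = (n + 1) * n := by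
        exact_mod_cast Finset.sum_range_id_mul_two (n + 1)
      push_cast at h7
      linarith
    have h8 : ∑ i ∈ Finset.range (n + 1), (i : ℝ) * Z i
        ≤ 4 * s * (n + 1) * ℓ + R * n / 8 := by
      have h9 := h2.trans (add_le_add_right h3 _)
      simp only [mul_assoc (1 / (4 * s * ((n : ℝ) + 1))), ← Finset.mul_sum] at h9
      have h10 := mul_le_mul_of_nonneg_left h9
        (by positivity : 0 ≤ 4 * s * ((n : ℝ) + 1))
      have e1 : 4 * s * ((n : ℝ) + 1) * (1 / (4 * s * (n + 1))
          * ∑ i ∈ Finset.range (n + 1), (i : ℝ) * Z i)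
          = ∑ i ∈ Finset.range (n + 1), (i : ℝ) * Z i := by
        field_simp
      have e2 : 4 * s * ((n : ℝ) + 1) * (ℓ + (1 / (4 * s * (n + 1))) ^ 2 * s *
          (R * ((n : ℝ) * (n + 1) / 2))) = 4 * s * (n + 1) * ℓ + R * n / 8 := by
        field_simp
        ring
      rw [e1, e2] at h10
      exact h10
    push_cast
    have h11 : ((n : ℝ) + 1) * n * a (n + 1)
        ≤ (n + 1) * (4 / 15 * R) + n * (R / 4 + 9 / 25 * R) := by
      have h12 := mul_le_mul_of_nonneg_left hℓ (by positivity : (0 : ℝ) ≤ n + 1)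
      have h13 := mul_le_mul_of_nonneg_left hB (by positivity : (0 : ℝ) ≤ n)
      linarith
    -- The fractions `4/15 + 1/4 + 9/25` sum to less than `1`; for `n ≥ 19` the gap absorbs the
    -- passage from `n` to `n + 2`. Earlier times are covered by `hsmall`.
    have h14 : ((n : ℝ) + 1 + 1) * ((n + 1) * (4 / 15) + n * (1 / 4 + 9 / 25)) ≤ (n + 1) * n := by
      nlinarith
    have h15 := mul_le_mul_of_nonneg_left h11 (by positivity : (0 : ℝ) ≤ n + 1 + 1)
    have h16 := mul_le_mul_of_nonneg_right h14 hR
    have hpos : 0 < ((n : ℝ) + 1) * n := by positivity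
    refine le_of_mul_le_mul_left ?_ hpos
    linarith

end Recursion

/-! ### Measurability of the iterates. -/

section Measurability

variable {d : ℕ}

instance instMeasurableSpaceMat : MeasurableSpace (Mat d) := borel _

instance instBorelSpaceMat : BorelSpace (Mat d) := ⟨rfl⟩

instance instSecondCountableMat : SecondCountableTopology (Mat d) :=
  inferInstanceAs (SecondCountableTopology (Fin d → Fin d → ℝ))

lemma measurable_matrix_inv : Measurable fun A : Mat d => A⁻¹ := by
  have h1 : Measurable fun A : Mat d => A.det := (Continuous.matrix_det continuous_id).measurable
  have h2 : Measurable fun A : Mat d => A.adjugate :=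
    (Continuous.matrix_adjugate continuous_id).measurable
  simp only [Matrix.inv_def, Ring.inverse_eq_inv']
  exact h1.inv.smul h2

variable {τ ζ : ℝ}

/-- `𝒮'` is the fixed point set of a continuous map, hence closed. -/
lemma measurableSet_precSet (hτ : 0 < τ) (hτζ : τ ≤ ζ) : MeasurableSet (precSet d τ ζ) := by
  have h : precSet d τ ζ = {A | proj τ ζ A = A} := by
    ext A
    refine ⟨fun hA => (eq_proj hτ hτζ A A hA fun X _ => ?_).symm, fun hA => ?_⟩
    · rw [sub_self, norm_zero]; exact norm_nonneg _
    · rw [← show proj τ ζ A = A from hA]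
      exact (proj_spec hτ hτζ A).1
  rw [h]
  exact (isClosed_eq (continuous_proj hτ hτζ) continuous_id).measurableSet

/-- On `𝒮'` the estimate agrees with a jointly measurable function. -/
lemma exists_measurable_precGrad (hτ : 0 < τ) (hτζ : τ ≤ ζ) (H : Mat d) :
    ∃ g : Mat d × Vec d → Mat d, Measurable g ∧
      ∀ X ∈ precSet d τ ζ, ∀ u, g (X, u) = precGrad H X u := by
  classical
  -- The square root is known to be continuous only on `𝒮'`; the value `0` elsewhere is never
  -- reached by the iterates.
  set ψ : Mat d → Mat d := (precSet d τ ζ).piecewise matSqrt fun _ => 0 with hψ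
  have hψm : Measurable ψ := (continuousOn_matSqrt hτ hτζ).measurable_piecewise
    continuousOn_const (measurableSet_precSet hτ hτζ)
  have hmul : Measurable fun p : Mat d × Mat d => p.1 * p.2 :=
    (continuous_fst.mul continuous_snd).measurable
  have happ : Measurable fun p : Mat d × Vec d => app p.1 p.2 := continuous_app.measurable
  have hout : Measurable (outer : Vec d → Mat d) := by
    refine Continuous.measurable ?_
    unfold outer
    exact Continuous.matrix_vecMulVec (by fun_prop) (by fun_prop)
  have hR : Measurable fun p : Mat d × Vec d => ψ p.1 := hψm.comp measurable_fst
  have hQ : Measurable fun p : Mat d × Vec d => (ψ p.1)⁻¹ := measurable_matrix_inv.comp hR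
  have hQu : Measurable fun p : Mat d × Vec d => app (ψ p.1)⁻¹ p.2 :=
    happ.comp (hQ.prodMk measurable_snd)
  have hRu : Measurable fun p : Mat d × Vec d => ψ p.1 * outer p.2 * ψ p.1 :=
    hmul.comp ((hmul.comp (hR.prodMk (hout.comp measurable_snd))).prodMk hR)
  refine ⟨fun p => (1 / 2 * quad H (app (ψ p.1)⁻¹ p.2)) • (ψ p.1 * outer p.2 * ψ p.1 - p.1) - p.1,
    ?_, fun X hX u => ?_⟩
  · exact ((((continuous_quad H).measurable.comp hQu).const_mul _).smul
      (hRu.sub measurable_fst)).sub measurable_fst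
  · obtain ⟨-, -, -, -, hQR, hRQ, hRe⟩ := sqrt_inv_facts hτ hτζ hX
    have h1 : ψ X = matSqrt X := Set.piecewise_eq_of_mem _ _ _ hX
    have h2 : (matSqrt X)⁻¹ = matSqrt X⁻¹ := by
      rw [← hRe]
      exact Matrix.inv_eq_right_inv hRQ
    simp only [h1, h2]
    rw [precGrad, hRe]

lemma measurable_precIter (hτ : 0 < τ) (hτζ : τ ≤ ζ) (H : Mat d) {X₁ : Mat d}
    (hX₁ : X₁ ∈ precSet d τ ζ) (n : ℕ) :
    Measurable fun v : ℕ → Vec d => precIter τ ζ H X₁ v n := by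
  obtain ⟨g, hg, hgX⟩ := exists_measurable_precGrad (d := d) hτ hτζ H
  induction n with
  | zero => exact measurable_const
  | succ n ih =>
    simp only [precIter, ← hgX _ (precIter_mem hτ hτζ H hX₁ _ n)]
    have h1 : Measurable fun v : ℕ → Vec d => g (precIter τ ζ H X₁ v n, v (n + 1)) :=
      hg.comp (ih.prodMk (measurable_pi_apply (n + 1)))
    exact (continuous_proj hτ hτζ).measurable.comp (ih.add (h1.const_smul (1 / ((n + 1 : ℕ) : ℝ))))

lemma measurable_frob : Measurable fun p : Mat d × Mat d => frob p.1 p.2 := by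
  refine Continuous.measurable ?_
  unfold frob
  fun_prop

lemma measurable_frob_comp {γ : Type*} [MeasurableSpace γ] {A B : γ → Mat d}
    (hA : Measurable A) (hB : Measurable B) : Measurable fun x => frob (A x) (B x) :=
  measurable_frob.comp (hA.prodMk hB)

lemma measurable_mat_sub {γ : Type*} [MeasurableSpace γ] {A B : γ → Mat d}
    (hA : Measurable A) (hB : Measurable B) : Measurable fun x => A x - B x :=
  hA.sub hB

lemma measurable_norm_sq : Measurable fun A : Mat d => ‖A‖ ^ 2 := by
  simp only [← frob_self]
  exact measurable_frob.comp (measurable_id.prodMk measurable_id)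

end Measurability

/-! ### The exponential supermartingale. -/

section ExponentialProcess

variable {d : ℕ} {τ ζ : ℝ}

/-- The exponent of the exponential supermartingale of the truncated noise. -/
noncomputable def expProcess (τ ζ : ℝ) (H X₁ : Mat d) (c s : ℝ) (v : ℕ → Vec d) (n : ℕ) : ℝ :=
  ∑ i ∈ Finset.range n, (min (c * i * iterNoise τ ζ H X₁ v i) 1
    - (c * i) ^ 2 * (s * ‖precIter τ ζ H X₁ v i - proj τ ζ H‖ ^ 2))

lemma iterNoise_congr (H X₁ : Mat d) {v w : ℕ → Vec d} {n : ℕ} (h : ∀ j ≤ n + 1, v j = w j) :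
    iterNoise τ ζ H X₁ v n = iterNoise τ ζ H X₁ w n := by
  rw [iterNoise, iterNoise, precIter_congr H X₁ fun j hj => h j (hj.trans n.le_succ),
    h (n + 1) le_rfl]

lemma expProcess_congr (H X₁ : Mat d) (c s : ℝ) {v w : ℕ → Vec d} {n : ℕ}
    (h : ∀ j ≤ n, v j = w j) :
    expProcess τ ζ H X₁ c s v n = expProcess τ ζ H X₁ c s w n := by
  refine Finset.sum_congr rfl fun i hi => ?_
  have hi' := Finset.mem_range.1 hi
  rw [iterNoise_congr H X₁ fun j hj => h j (by omega),
    precIter_congr H X₁ fun j hj => h j (by omega)]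

lemma measurable_iterNoise (hτ : 0 < τ) (hτζ : τ ≤ ζ) (H : Mat d) {X₁ : Mat d}
    (hX₁ : X₁ ∈ precSet d τ ζ) (n : ℕ) :
    Measurable fun v : ℕ → Vec d => iterNoise τ ζ H X₁ v n := by
  obtain ⟨g, hg, hgX⟩ := exists_measurable_precGrad (d := d) hτ hτζ H
  have hX := measurable_precIter hτ hτζ H hX₁ n
  have e : (fun v : ℕ → Vec d => iterNoise τ ζ H X₁ v n) = fun v =>
      frob (g (precIter τ ζ H X₁ v n, v (n + 1)) - (H - precIter τ ζ H X₁ v n))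
        (precIter τ ζ H X₁ v n - proj τ ζ H) := by
    funext v
    rw [hgX _ (precIter_mem hτ hτζ H hX₁ v n), iterNoise]
  rw [e]
  have h1 : Measurable fun v : ℕ → Vec d => g (precIter τ ζ H X₁ v n, v (n + 1)) :=
    hg.comp (hX.prodMk (measurable_pi_apply (n + 1)))
  exact measurable_frob_comp (measurable_mat_sub h1 (measurable_mat_sub measurable_const hX))
    (measurable_mat_sub hX measurable_const)

lemma measurable_expProcess (hτ : 0 < τ) (hτζ : τ ≤ ζ) (H : Mat d) {X₁ : Mat d}
    (hX₁ : X₁ ∈ precSet d τ ζ) (c s : ℝ) (n : ℕ) :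
    Measurable fun v : ℕ → Vec d => expProcess τ ζ H X₁ c s v n := by
  refine Finset.measurable_fun_sum _ fun i _ => ?_
  have h1 : Measurable fun v : ℕ → Vec d => precIter τ ζ H X₁ v i - proj τ ζ H :=
    measurable_mat_sub (measurable_precIter hτ hτζ H hX₁ i) measurable_const
  exact (((measurable_iterNoise hτ hτζ H hX₁ i).const_mul _).min measurable_const).sub
    (((measurable_norm_sq.comp h1).const_mul s).const_mul _)

/-- Integration over an independent variable first. -/
lemma lintegral_of_indepFun {Ω α β : Type*} [MeasurableSpace Ω] [MeasurableSpace α]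
    [MeasurableSpace β] {P : Measure Ω} [IsProbabilityMeasure P] {h : Ω → α} {x : Ω → β}
    (hh : Measurable h) (hx : Measurable x) (hind : IndepFun h x P) {F : α × β → ENNReal}
    (hF : Measurable F) :
    ∫⁻ ω, F (h ω, x ω) ∂P = ∫⁻ ω, ∫⁻ y, F (h ω, y) ∂(P.map x) ∂P := by
  have := Measure.isProbabilityMeasure_map (μ := P) hx.aemeasurable
  have := Measure.isProbabilityMeasure_map (μ := P) hh.aemeasurable
  rw [← lintegral_map (f := F) (g := fun ω => (h ω, x ω)) hF (hh.prodMk hx),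
    (indepFun_iff_map_prod_eq_prod_map_map hh.aemeasurable hx.aemeasurable).1 hind,
    lintegral_prod _ hF.aemeasurable,
    lintegral_map (f := fun a => ∫⁻ y, F (a, y) ∂(P.map x)) hF.lintegral_prod_right' hh]

/-- The exponential process is a supermartingale started at one. -/
lemma lintegral_exp_expProcess_le {Ω : Type*} [MeasurableSpace Ω] {P : Measure Ω}
    [IsProbabilityMeasure P] {V : ℕ → Ω → Vec d} (hVm : ∀ k, Measurable (V k))
    (hVl : ∀ k, P.map (V k) = stdGaussian (Vec d)) (hVi : iIndepFun V P)
    (hτ : 0 < τ) (hτζ : τ ≤ ζ) {H X₁ : Mat d} (hX₁ : X₁ ∈ precSet d τ ζ) {L : ℝ} (hL0 : 0 ≤ L)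
    (hH : H.IsSymm) (hHL : ∀ v, |quad H v| ≤ L * ‖v‖ ^ 2) {c s : ℝ}
    (hs : (d ^ 2 + 30 * d) * (L / τ * ζ) ^ 2 ≤ s) (n : ℕ) :
    ∫⁻ ω, ENNReal.ofReal (Real.exp (expProcess τ ζ H X₁ c s (fun j => V j ω) n)) ∂P ≤ 1 := by
  classical
  induction n with
  | zero => simp [expProcess]
  | succ n ih =>
    set S : Finset ℕ := Finset.range (n + 1)
    -- The default value `0` is harmless: the iterate with index `n` reads only samples with index
    -- at most `n`.
    set ext : (S → Vec d) → ℕ → Vec d := fun h j => if hj : j ∈ S then h ⟨j, hj⟩ else 0 with hext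
    have hextm : Measurable ext := by
      refine measurable_pi_lambda _ fun j => ?_
      by_cases hj : j ∈ S
      · simp only [hext, hj, dite_true]; exact measurable_pi_apply _
      · simp only [hext, hj, dite_false]; exact measurable_const
    set hist : Ω → S → Vec d := fun ω j => V j ω with hhist
    have hhistm : Measurable hist := measurable_pi_lambda _ fun j => hVm j
    have hagree : ∀ ω, ∀ j ≤ n, V j ω = ext (hist ω) j := by
      intro ω j hj
      have hjS : j ∈ S := Finset.mem_range.2 (by omega)
      simp [hext, hhist, hjS]
    have hind : IndepFun hist (V (n + 1)) P := by
      have h1 := hVi.indepFun_finset S {n + 1} (by simp [S]) hVm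
      exact h1.comp (φ := id)
        (ψ := fun h : ({n + 1} : Finset ℕ) → Vec d => h ⟨n + 1, Finset.mem_singleton_self _⟩)
        measurable_id (measurable_pi_apply _)
    obtain ⟨g, hg, hgX⟩ := exists_measurable_precGrad (d := d) hτ hτζ H
    set X : (S → Vec d) → Mat d := fun h => precIter τ ζ H X₁ (ext h) n with hXdef
    have hXm : Measurable X := (measurable_precIter hτ hτζ H hX₁ n).comp hextm
    have hXmem : ∀ h, X h ∈ precSet d τ ζ := fun h => precIter_mem hτ hτζ H hX₁ _ n
    set pen : (S → Vec d) → ℝ := fun h => (c * n) ^ 2 * (s * ‖X h - proj τ ζ H‖ ^ 2) with hpen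
    have hDm : Measurable fun h => X h - proj τ ζ H :=
      measurable_mat_sub hXm measurable_const
    have hpenm : Measurable pen :=
      ((measurable_norm_sq.comp hDm).const_mul s).const_mul _
    set E : (S → Vec d) → ℝ := fun h => expProcess τ ζ H X₁ c s (ext h) n with hE
    have hEm : Measurable E := (measurable_expProcess hτ hτζ H hX₁ c s n).comp hextm
    set Z : (S → Vec d) × Vec d → ℝ := fun p =>
      frob (g (X p.1, p.2) - (H - X p.1)) (X p.1 - proj τ ζ H) with hZ
    have hXf : Measurable fun p : (S → Vec d) × Vec d => X p.1 := hXm.comp measurable_fst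
    have hGf : Measurable fun p : (S → Vec d) × Vec d => g (X p.1, p.2) :=
      hg.comp (hXf.prodMk measurable_snd)
    have hZm : Measurable Z := measurable_frob_comp
      (measurable_mat_sub hGf (measurable_mat_sub measurable_const hXf))
      (measurable_mat_sub hXf measurable_const)
    set F : (S → Vec d) × Vec d → ENNReal := fun p =>
      ENNReal.ofReal (Real.exp (E p.1 - pen p.1)) *
        ENNReal.ofReal (Real.exp (min (c * n * Z p) 1)) with hFdef
    have hFm : Measurable F :=
      ((((hEm.comp measurable_fst).sub (hpenm.comp measurable_fst)).exp).ennreal_ofReal).mul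
        ((((hZm.const_mul _).min measurable_const).exp).ennreal_ofReal)
    have hFeq : ∀ ω, ENNReal.ofReal (Real.exp (expProcess τ ζ H X₁ c s (fun j => V j ω) (n + 1)))
        = F (hist ω, V (n + 1) ω) := by
      intro ω
      have h1 : expProcess τ ζ H X₁ c s (fun j => V j ω) n = E (hist ω) :=
        expProcess_congr H X₁ c s (hagree ω)
      have h2 : precIter τ ζ H X₁ (fun j => V j ω) n = X (hist ω) :=
        precIter_congr H X₁ (hagree ω)
      have h3 : iterNoise τ ζ H X₁ (fun j => V j ω) n = Z (hist ω, V (n + 1) ω) := by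
        simp only [iterNoise, h2, hZ, hgX _ (hXmem _)]
      simp only [hFdef]
      rw [← ENNReal.ofReal_mul (Real.exp_pos _).le, ← Real.exp_add, expProcess,
        Finset.sum_range_succ, ← expProcess, h1, h2, h3]
      congr 2
      simp only [hpen]
      ring
    simp only [hFeq]
    -- With the past frozen, the new sample is integrated out first; the penalty `pen` then
    -- compensates its exponential moment.
    rw [lintegral_of_indepFun hhistm (hVm (n + 1)) hind hFm, hVl]
    refine le_trans (lintegral_mono fun ω => ?_) ih
    have hsymm : (X (hist ω) - proj τ ζ H).IsSymm :=
      (precSet_isSymm hτ hτζ (hXmem _)).sub (precSet_isSymm hτ hτζ (proj_spec hτ hτζ H).1)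
    have h4 := lintegral_exp_min_noise_le hτ hτζ hL0 hH hHL (hXmem (hist ω)) hsymm (c * n)
    simp only [hFdef, hZ, hgX _ (hXmem _)]
    rw [lintegral_const_mul' _ _ ENNReal.ofReal_ne_top]
    refine (mul_le_mul_right h4 _).trans ?_
    rw [← ENNReal.ofReal_mul (Real.exp_pos _).le, ← Real.exp_add,
      expProcess_congr H X₁ c s (hagree ω)]
    refine ENNReal.ofReal_le_ofReal (Real.exp_le_exp.2 ?_)
    have h5 : (c * n) ^ 2 * ((d ^ 2 + 30 * d) * (L / τ * ζ) ^ 2 * ‖X (hist ω) - proj τ ζ H‖ ^ 2)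
        ≤ pen (hist ω) :=
      mul_le_mul_of_nonneg_left (mul_le_mul_of_nonneg_right hs (sq_nonneg _)) (sq_nonneg _)
    simp only [hE]
    linarith

/-- Markov's inequality for the exponential. -/
lemma measureReal_le_expProcess_le {Ω : Type*} [MeasurableSpace Ω] {P : Measure Ω}
    [IsProbabilityMeasure P] {V : ℕ → Ω → Vec d} (hVm : ∀ k, Measurable (V k))
    (hVl : ∀ k, P.map (V k) = stdGaussian (Vec d)) (hVi : iIndepFun V P)
    (hτ : 0 < τ) (hτζ : τ ≤ ζ) {H X₁ : Mat d} (hX₁ : X₁ ∈ precSet d τ ζ) {L : ℝ} (hL0 : 0 ≤ L)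
    (hH : H.IsSymm) (hHL : ∀ v, |quad H v| ≤ L * ‖v‖ ^ 2) {c s : ℝ}
    (hs : (d ^ 2 + 30 * d) * (L / τ * ζ) ^ 2 ≤ s) (n : ℕ) (ℓ : ℝ) :
    P.real {ω | ℓ ≤ expProcess τ ζ H X₁ c s (fun j => V j ω) n} ≤ Real.exp (-ℓ) := by
  have h := lintegral_exp_expProcess_le hVm hVl hVi hτ hτζ hX₁ hL0 hH hHL (c := c) hs n
  have hm : Measurable fun ω =>
      ENNReal.ofReal (Real.exp (expProcess τ ζ H X₁ c s (fun j => V j ω) n)) :=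
    ((measurable_expProcess hτ hτζ H hX₁ c s n).comp
      (measurable_pi_lambda _ hVm)).exp.ennreal_ofReal
  have h2 := (mul_meas_ge_le_lintegral hm (ENNReal.ofReal (Real.exp ℓ))).trans h
  have h3 : {ω | ENNReal.ofReal (Real.exp ℓ)
      ≤ ENNReal.ofReal (Real.exp (expProcess τ ζ H X₁ c s (fun j => V j ω) n))}
      = {ω | ℓ ≤ expProcess τ ζ H X₁ c s (fun j => V j ω) n} := by
    ext ω
    simp only [Set.mem_ofPred_eq]
    rw [ENNReal.ofReal_le_ofReal_iff (Real.exp_pos _).le, Real.exp_le_exp]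
  rw [h3] at h2
  have h4 := ENNReal.toReal_mono ENNReal.one_ne_top h2
  rw [ENNReal.toReal_mul, ENNReal.toReal_ofReal (Real.exp_pos _).le, ENNReal.toReal_one] at h4
  rw [Real.exp_neg, ← one_div, le_div_iff₀ (Real.exp_pos _), mul_comm]
  exact h4

end ExponentialProcess

/-! ### Numerical bounds in terms of `M`. -/

section Constants

/-- Completing the square: `2d - 7√d + 49/8 = 2 (√d - 7/4)²`, and `31/5` exceeds `49/8`. -/
lemma seven_mul_sqrt_le {d : ℕ} {M : ℝ} (hM : 2 * (d : ℝ) + 31 / 5 ≤ M) :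
    7 * √(d : ℝ) ≤ M := by
  have hd : (0 : ℝ) ≤ d := d.cast_nonneg
  have h := Real.sq_sqrt hd
  nlinarith [sq_nonneg (2 * √(d : ℝ) - 7 / 2)]

lemma sqrt_le_sq_div {d : ℕ} {M : ℝ} (hM : 2 * (d : ℝ) + 31 / 5 ≤ M) :
    √(d : ℝ) ≤ M ^ 2 / 49 := by
  have h7 := seven_mul_sqrt_le hM
  have hd : (0 : ℝ) ≤ d := d.cast_nonneg
  have hM7 : √(d : ℝ) ≤ M * M / 49 := by
    rcases Nat.eq_zero_or_pos d with h | h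
    · subst h; simp; positivity
    · have h1 : (1 : ℝ) ≤ d := by exact_mod_cast h
      nlinarith
  linarith [sq M]

lemma sq_add_le_cube_div {d : ℕ} {M : ℝ} (hM : 2 * (d : ℝ) + 31 / 5 ≤ M) :
    (d : ℝ) ^ 2 + 30 * d ≤ M ^ 3 / 10 := by
  have hd : (0 : ℝ) ≤ d := d.cast_nonneg
  have h := pow_le_pow_left₀ (by positivity) hM 3
  nlinarith [sq_nonneg ((d : ℝ) - 1 / 2), mul_nonneg hd (sq_nonneg (d : ℝ))]

lemma mul_le_pow_four {d : ℕ} {M : ℝ} (hM : 2 * (d : ℝ) + 31 / 5 ≤ M) :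
    84 * (d : ℝ) ≤ M ^ 4 := by
  have h7 := seven_mul_sqrt_le hM
  have h := pow_le_pow_left₀ (by positivity) h7 4
  have e : (7 * √(d : ℝ)) ^ 4 = 2401 * (d : ℝ) ^ 2 := by
    rw [mul_pow, show √(d : ℝ) ^ 4 = (√(d : ℝ) ^ 2) ^ 2 by ring, Real.sq_sqrt d.cast_nonneg]
    norm_num
  rw [e] at h
  have h2 : (d : ℝ) ≤ d ^ 2 := by exact_mod_cast Nat.le_self_pow two_ne_zero d
  nlinarith [sq_nonneg (d : ℝ)]

lemma estimate_const_le {d : ℕ} {M c ζ : ℝ} (hM : 2 * (d : ℝ) + 31 / 5 ≤ M) (hζ : 0 < ζ)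
    (hc : ζ ≤ c) :
    (1 / 2 * c * (M * (M + √d)) + ζ * √d) ^ 2 ≤ 9 / 25 * (c ^ 2 * M ^ 4) := by
  have h7 := seven_mul_sqrt_le hM
  have hs := sqrt_le_sq_div hM
  have hM0 : 0 < M := by linarith [d.cast_nonneg (α := ℝ)]
  have hc0 := hζ.trans_le hc
  have h1 : 1 / 2 * c * (M * (M + √d)) + ζ * √d ≤ 3 / 5 * (c * M ^ 2) := by
    have a1 : M * (M + √d) ≤ 8 / 7 * M ^ 2 := by nlinarith
    have a2 : ζ * √d ≤ c * (M ^ 2 / 49) := by gcongr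
    have a3 := mul_le_mul_of_nonneg_left a1 hc0.le
    have a4 : 0 ≤ c * M ^ 2 := by positivity
    linarith
  have h2 := pow_le_pow_left₀ (by positivity) h1 2
  linarith [show (3 / 5 * (c * M ^ 2)) ^ 2 = 9 / 25 * (c ^ 2 * M ^ 4) by ring]

lemma noise_const_le {d : ℕ} {M c ζ : ℝ} (hM : 2 * (d : ℝ) + 31 / 5 ≤ M) (hζ : 0 < ζ)
    (hc : ζ ≤ c) :
    (1 / 2 * M * (M + √d) + √(d ^ 2 + 30 * d)) * c * (2 * √d * ζ)
      ≤ 4 * (c ^ 2 * M ^ 3 / 10) := by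
  have h7 := seven_mul_sqrt_le hM
  have hM6 : 31 / 5 ≤ M := by linarith [d.cast_nonneg (α := ℝ)]
  have hM0 : 0 < M := by linarith
  have hc0 := hζ.trans_le hc
  have h1 : √((d : ℝ) ^ 2 + 30 * d) ≤ M ^ 2 / 7 := by
    refine Real.sqrt_le_iff.2 ⟨by positivity, (sq_add_le_cube_div hM).trans ?_⟩
    nlinarith [pow_pos hM0 3]
  have h2 : 1 / 2 * M * (M + √d) + √(d ^ 2 + 30 * d) ≤ 5 / 7 * M ^ 2 := by nlinarith
  have h3 : 2 * √(d : ℝ) * ζ ≤ 2 / 7 * M * c := by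
    calc 2 * √(d : ℝ) * ζ ≤ 2 / 7 * M * ζ :=
          mul_le_mul_of_nonneg_right (by linarith) hζ.le
      _ ≤ _ := mul_le_mul_of_nonneg_left hc (by positivity)
  calc (1 / 2 * M * (M + √d) + √(d ^ 2 + 30 * d)) * c * (2 * √d * ζ)
      ≤ (5 / 7 * M ^ 2) * c * (2 / 7 * M * c) := by gcongr
    _ = 10 / 49 * (c ^ 2 * M ^ 3) := by ring
    _ ≤ _ := by
      have : 0 ≤ c ^ 2 * M ^ 3 := by positivity
      linarith

/-- All other summands of the constant are nonnegative and can be dropped. -/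
lemma pow_four_le_rateConst {d T : ℕ} {L ζ τ δ : ℝ} (hτ : 0 < τ) (hτζ : τ ≤ ζ) (hτL : τ ≤ L)
    (hδ : δ ∈ Set.Ioo (0 : ℝ) (1 / 2)) :
    (L / τ * ζ) ^ 2 * (2 * (d : ℝ) + 3 * Real.log (T / δ)) ^ 4 ≤ rateConst d L ζ τ δ T := by
  have hζ := hτ.trans_le hτζ
  have hL := hτ.trans_le hτL
  have hlog : 0 ≤ Real.log ((12 + 2592 * (T : ℝ)) / δ) := by
    refine Real.log_nonneg ?_
    rw [one_le_div hδ.1]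
    have := hδ.2
    have : (0 : ℝ) ≤ T := T.cast_nonneg
    linarith
  have hd3 : 0 ≤ ζ ^ 2 - τ ^ 2 := sub_nonneg.2 (pow_le_pow_left₀ hτ.le hτζ 2)
  have h1 : 0 ≤ 16 * (16 * (d : ℝ) ^ 2 * ζ ^ 2 * L / τ
      + 2 * (d : ℝ) ^ 3 * L * (ζ ^ 2 - τ ^ 2) / τ
      + d * L * ζ + d * L ^ 2) * Real.log ((12 + 2592 * (T : ℝ)) / δ) ^ ((5 : ℝ) / 4) :=
    mul_nonneg (by positivity) (Real.rpow_nonneg hlog _)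
  have h2 : (L / τ * ζ) ^ 2 = L ^ 2 * ζ ^ 2 / τ ^ 2 := by field_simp
  rw [rateConst, h2]
  have h3 : 0 ≤ L ^ 2 * ζ ^ 2 / τ ^ 2 * (2 * (d : ℝ) + 3 * Real.log (T / δ)) ^ 2 := by positivity
  have h4 : 0 ≤ 2 * L ^ 2 := by positivity
  linarith

end Constants

/-! ### The good event and the theorem. -/

section HighProbability

variable {d : ℕ} {τ ζ : ℝ}

/-- On the good event the errors decay at the claimed rate. -/
lemma rate_of_good_event (hτ : 0 < τ) (hτζ : τ ≤ ζ) {H X₁ : Mat d} {L M ℓ R : ℝ} (hτL : τ ≤ L)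
    (hH : H.IsSymm) (hHL : ∀ v, |quad H v| ≤ L * ‖v‖ ^ 2) (hX₁ : X₁ ∈ precSet d τ ζ)
    (hM : 2 * (d : ℝ) + 31 / 5 ≤ M) (hMℓ : 3 * ℓ ≤ M)
    (hR : (L / τ * ζ) ^ 2 * M ^ 4 ≤ R) {v : ℕ → Vec d} {T : ℕ}
    (hv : ∀ j, 1 ≤ j → j ≤ T → ‖v j‖ ^ 2 ≤ M)
    (hdev : ∀ n < T, expProcess τ ζ H X₁
      (1 / (4 * ((L / τ * ζ) ^ 2 * M ^ 3 / 10) * (n + 1)))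
      ((d ^ 2 + 30 * d) * (L / τ * ζ) ^ 2) v (n + 1) ≤ ℓ) :
    ∀ n < T, ((n : ℝ) + 1) * ‖precIter τ ζ H X₁ v n - proj τ ζ H‖ ^ 2 ≤ R := by
  have hζ := hτ.trans_le hτζ
  have hL := hτ.trans_le hτL
  have hM0 : 0 < M := by linarith [d.cast_nonneg (α := ℝ)]
  have hc : ζ ≤ L / τ * ζ := le_mul_of_one_le_left hζ.le ((one_le_div hτ).2 hτL)
  set c := L / τ * ζ with hcdef
  have hc0 : 0 < c := hζ.trans_le hc
  -- One scale for three tasks: it dominates the variance factor `(d² + 30d) c²`, `4 s` bounds the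
  -- noise, and `8 s ℓ ≤ (4/15) c² M⁴` because `3 ℓ ≤ M`.
  set s := c ^ 2 * M ^ 3 / 10 with hsdef
  have hs : 0 < s := by positivity
  have hcM : 0 < c ^ 2 * M ^ 4 := by positivity
  have hP := (proj_spec hτ hτζ H).1
  have hmem := precIter_mem hτ hτζ H hX₁ v
  have herr : ∀ n, ‖precIter τ ζ H X₁ v n - proj τ ζ H‖ ^ 2 ≤ 4 * d * ζ ^ 2 := fun n =>
    norm_sub_sq_le_of_mem_precSet hτ hτζ (hmem n) hP
  refine rate_of_recursion (Z := iterNoise τ ζ H X₁ v)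
    (B := (1 / 2 * c * (M * (M + √d)) + ζ * √d) ^ 2) (s := s) (ℓ := ℓ) hs (hcM.le.trans hR)
    (sq_nonneg _) (fun n => sq_nonneg _) ?_ ?_ ?_ ?_ ?_
  · intro n hn
    refine sq_error_recursion hτ hτζ H hX₁ v n (pow_le_pow_left₀ (norm_nonneg _) ?_ 2)
    refine (norm_precGrad_le hτ hτζ hL.le hHL (hmem n) (hv (n + 1) (by omega) (by omega))).trans_eq
      ?_
    rw [hcdef]
    ring
  · intro n hn
    have h1 := hdev n (by omega)
    rw [expProcess, Finset.sum_sub_distrib] at h1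
    have h2 : ∀ i ∈ Finset.range (n + 1),
        min (1 / (4 * s * ((n : ℝ) + 1)) * i * iterNoise τ ζ H X₁ v i) 1
          = 1 / (4 * s * (n + 1)) * i * iterNoise τ ζ H X₁ v i := by
      intro i hi
      have hi' := Finset.mem_range.1 hi
      -- For bounded samples `|Z_i| ≤ 4 s`, and `i ≤ n + 1`, so the factor `1 / (4 s (n+1))` keeps
      -- the exponent below the truncation level.
      refine min_eq_left ?_
      have hsymm : (precIter τ ζ H X₁ v i - proj τ ζ H).IsSymm :=
        (precSet_isSymm hτ hτζ (hmem i)).sub (precSet_isSymm hτ hτζ hP)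
      have h3 := abs_noise_le hτ hτζ hL.le hH hHL (hmem i) hsymm
        (hv (i + 1) (by omega) (by omega))
      have h4 : ‖precIter τ ζ H X₁ v i - proj τ ζ H‖ ≤ 2 * √d * ζ := by
        refine (sq_le_sq₀ (norm_nonneg _) (by positivity)).1 ((herr i).trans_eq ?_)
        rw [mul_pow, mul_pow, Real.sq_sqrt d.cast_nonneg]
        ring
      have h5 : |iterNoise τ ζ H X₁ v i| ≤ 4 * s := by
        refine (h3.trans (mul_le_mul_of_nonneg_left h4 (by positivity))).trans ?_
        exact noise_const_le hM hζ hc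
      have h6 : (i : ℝ) ≤ n + 1 := by exact_mod_cast hi'.le
      have h7 : (i : ℝ) * iterNoise τ ζ H X₁ v i ≤ (n + 1) * (4 * s) :=
        (mul_le_mul_of_nonneg_left ((le_abs_self _).trans h5) i.cast_nonneg).trans
          (mul_le_mul_of_nonneg_right h6 (by positivity))
      rw [mul_assoc, one_div, inv_mul_le_one₀ (by positivity)]
      linarith
    rw [Finset.sum_congr rfl h2] at h1
    have h8 : ∑ i ∈ Finset.range (n + 1), (1 / (4 * s * ((n : ℝ) + 1)) * i) ^ 2
          * ((d ^ 2 + 30 * d) * c ^ 2 * ‖precIter τ ζ H X₁ v i - proj τ ζ H‖ ^ 2)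
        ≤ ∑ i ∈ Finset.range (n + 1), (1 / (4 * s * ((n : ℝ) + 1)) * i) ^ 2
          * (s * ‖precIter τ ζ H X₁ v i - proj τ ζ H‖ ^ 2) := by
      have h9 : ((d : ℝ) ^ 2 + 30 * d) * c ^ 2 ≤ s := by
        have := mul_le_mul_of_nonneg_right (sq_add_le_cube_div hM) (sq_nonneg c)
        rw [hsdef]
        linarith
      gcongr
    linarith
  · intro n hn
    have h1 : (n : ℝ) + 1 ≤ 21 := by
      have : (n : ℝ) ≤ 20 := by exact_mod_cast hn.le
      linarith
    have h2 := mul_le_mul h1 (herr n) (sq_nonneg _) (by norm_num)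
    have h3 : 84 * (d : ℝ) * ζ ^ 2 ≤ M ^ 4 * c ^ 2 :=
      mul_le_mul (mul_le_pow_four hM) (pow_le_pow_left₀ hζ.le hc 2) (sq_nonneg _) (by positivity)
    linarith
  · have h1 : 8 * s * ℓ ≤ 8 * s * (M / 3) := by gcongr; linarith
    have h2 : 8 * s * (M / 3) = 4 / 15 * (c ^ 2 * M ^ 4) := by rw [hsdef]; ring
    linarith
  · have := estimate_const_le hM hζ hc
    linarith

end HighProbability

end MiNES

open MiNES in
theorem mainTheorem2 {d : ℕ} {Ω : Type*} [MeasurableSpace Ω] (P : Measure Ω)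
    [IsProbabilityMeasure P]
    (f : MiNES.Vec d → ℝ) (H : MiNES.Mat d) (L τ ζ α : ℝ)
    (hf : MiNES.IsQuadratic f H) (hL : MiNES.IsSmooth f L)
    (hτ : 0 < τ) (hτζ : τ ≤ ζ) (hτL : τ ≤ L) (hα : 0 < α)
    (η₁ : ℕ → ℝ) (μ₁ : MiNES.Vec d) (S₁ : MiNES.Mat d) (hS₁ : S₁ ∈ MiNES.covSet d τ ζ)
    (u : ℕ → Fin 1 → Ω → MiNES.Vec d)
    (hu_meas : ∀ k i, Measurable (u k i))
    (hu_law : ∀ k i, P.map (u k i) = stdGaussian (MiNES.Vec d))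
    (hu_indep : iIndepFun (fun (p : ℕ × Fin 1) => u p.1 p.2) P)
    (δ : ℝ) (hδ : δ ∈ Set.Ioo (0 : ℝ) (1 / 2)) (T : ℕ) (hT : 4 ≤ T) :
    1 - 2 * δ ≤ P.real {ω | ∀ k : ℕ, 1 ≤ k → k ≤ T →
      ‖(MiNES.iter f α τ ζ η₁ (fun j => 1 / (j : ℝ)) (μ₁, S₁) (fun j i => u j i ω) k).2⁻¹
          - MiNES.proj τ ζ H‖ ^ 2
        ≤ 1 / (k : ℝ) * MiNES.rateConst d L ζ τ δ T} := by
  have hX₁ : S₁⁻¹ ∈ precSet d τ ζ := ⟨S₁, hS₁, rfl⟩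
  have hHL := abs_quad_le hf hL
  have hTR : (4 : ℝ) ≤ T := by exact_mod_cast hT
  have hδ0 := hδ.1
  set ℓ := Real.log (T / δ) with hℓ
  set M := 2 * (d : ℝ) + 3 * ℓ with hMdef
  -- From `4 ≤ T` and `δ < 1/2`; then `3 ℓ ≥ 9 log 2 > 31/5`.
  have hTδ : (2 : ℝ) ^ 3 ≤ T / δ := by
    rw [le_div_iff₀ hδ0]
    have := hδ.2
    linarith
  have hexp : (T : ℝ) * Real.exp (-ℓ) = δ := by
    rw [Real.exp_neg, hℓ, Real.exp_log (by positivity)]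
    field_simp
  have hM : 2 * (d : ℝ) + 31 / 5 ≤ M := by
    have h1 := Real.log_le_log (by norm_num) hTδ
    rw [Real.log_pow] at h1
    have h2 := Real.log_two_gt_d9
    push_cast at h1
    linarith
  have hMℓ : 3 * ℓ ≤ M := by linarith [d.cast_nonneg (α := ℝ)]
  have hind : iIndepFun (fun j => u j 0) P :=
    hu_indep.precomp (g := fun j : ℕ => (j, (0 : Fin 1))) fun i j h => congrArg Prod.fst h
  set V : ℕ → Ω → Vec d := fun j => u j 0
  -- The parameter depends on the horizon `n`, so each `n < T` has its own supermartingale. Each of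
  -- the `T` events fails with probability at most `δ / T`.
  set lam : ℕ → ℝ := fun n => 1 / (4 * ((L / τ * ζ) ^ 2 * M ^ 3 / 10) * (n + 1))
  set v₀ : ℝ := (d ^ 2 + 30 * d) * (L / τ * ζ) ^ 2 with hv₀
  set A : Set Ω := ⋃ j ∈ Finset.Icc 1 T, {ω | M ≤ ‖V j ω‖ ^ 2}
  set E : Set Ω := ⋃ n ∈ Finset.range T,
    {ω | ℓ ≤ expProcess τ ζ H S₁⁻¹ (lam n) v₀ (fun j => V j ω) (n + 1)}
  have hA : P.real A ≤ δ := by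
    refine (measureReal_biUnion_finset_le _ _).trans ?_
    have h1 : ∀ j ∈ Finset.Icc 1 T, P.real {ω | M ≤ ‖V j ω‖ ^ 2} ≤ Real.exp (-ℓ) := by
      intro j _
      have h2 := stdGaussian_norm_sq_tail (d := d) ℓ
      rw [← hu_law j 0, map_measureReal_apply (hu_meas j 0)
        (measurableSet_le measurable_const (by fun_prop))] at h2
      exact h2
    refine (Finset.sum_le_card_nsmul _ _ _ h1).trans ?_
    rw [Nat.card_Icc, Nat.add_sub_cancel, nsmul_eq_mul, hexp]
  have hE : P.real E ≤ δ := by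
    refine (measureReal_biUnion_finset_le _ _).trans ?_
    have h1 := fun n (_ : n ∈ Finset.range T) => measureReal_le_expProcess_le
      (fun k => hu_meas k 0) (fun k => hu_law k 0) hind hτ hτζ hX₁ (hτ.le.trans hτL) hf.1 hHL
      (c := lam n) (s := v₀) le_rfl (n + 1) ℓ
    refine (Finset.sum_le_card_nsmul _ _ _ h1).trans ?_
    rw [Finset.card_range, nsmul_eq_mul, hexp]
  have hAE : P.real (A ∪ E) ≤ 2 * δ := (measureReal_union_le A E).trans (by linarith)
  -- Subadditivity suffices here, so the bad event need not be shown measurable.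
  have hcompl : 1 ≤ P.real (A ∪ E) + P.real (A ∪ E)ᶜ := by
    have h1 := measureReal_union_le (μ := P) (A ∪ E) (A ∪ E)ᶜ
    rwa [Set.union_compl_self, probReal_univ] at h1
  have hsub : P.real (A ∪ E)ᶜ ≤ P.real {ω | ∀ k : ℕ, 1 ≤ k → k ≤ T →
      ‖(MiNES.iter f α τ ζ η₁ (fun j => 1 / (j : ℝ)) (μ₁, S₁) (fun j i => u j i ω) k).2⁻¹
          - MiNES.proj τ ζ H‖ ^ 2
        ≤ 1 / (k : ℝ) * MiNES.rateConst d L ζ τ δ T} := by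
    refine measureReal_mono fun ω hω k hk hkT => ?_
    simp only [A, E, Set.compl_union, Set.mem_inter_iff, Set.mem_compl_iff, Set.mem_iUnion,
      Set.mem_ofPred_eq, not_exists, not_le, Finset.mem_Icc, Finset.mem_range] at hω
    obtain ⟨n, rfl⟩ : ∃ n, k = n + 1 := ⟨k - 1, by omega⟩
    have h1 := rate_of_good_event hτ hτζ hτL hf.1 hHL hX₁ hM hMℓ
      (pow_four_le_rateConst hτ hτζ hτL hδ) (v := fun j => V j ω) (T := T)
      (fun j h1 h2 => (hω.1 j ⟨h1, h2⟩).le) (fun n hn => (hω.2 n hn).le) n (by omega)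
    rw [(inv_iter_eq_precIter hτ hτζ hf hα η₁ μ₁ hS₁ (fun j i => u j i ω) n).1]
    push_cast
    rw [one_div, ← div_eq_inv_mul, le_div_iff₀ (by positivity), mul_comm]
    exact h1
  linarith
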